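/- Let $S^2\subset\mathbb R^3$ be the unit sphere with surface measure $dx$, and let $\Omega,\Omega^*\subseteq S^2$ with $|\partial\Omega|=0$ and $x\cdot m\le 1-\delta$ for all $x\in\bar\Omega$, $m\in\bar\Omega^*$, for some $0<\delta<1$. *Definitions.* For $d>0$ and $m\in S^2$ let $P_d(m)$ be the paraboloid of revolution with focus at the origin, axis direction $m$ and polar radius $\rho_d(x)=\dfrac{d}{1-x\cdot m}$, $x\in S^2\setminus\{m\}$. It supports a surface $\sigma=\{\rho(x)x\}_{x\in\bar\Omega}$ at $\rho(x_0)x_0$ if $\rho(x)\le\rho_d(x)$ for all $x\in\bar\Omega$, with equality at $x=x_0$. The surface $\sigma$ is a reflector from $\bar\Omega$ to $\bar\Omega^*$ if for each $x_0\in\bar\Omega$ some $P_d(m)$ with $m\in\bar\Omega^*$ supports $\sigma$ at $\rho(x_0)x_0$; it belongs to $\mathcal A(a)$ if, for each $x_0\in\bar\Omega$, such a paraboloid can be chosen with $d\ge 2a$. For $E\subseteq\bar\Omega^*$ let $\tau_\sigma(E)$ be the set of $x\in\bar\Omega$ such that some $P_d(m)$ with $m\in E$ supports $\sigma$ at $\rho(x)x$.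 Let $\nu_\rho(x)$ be the outer unit normal to $\sigma$ at $\rho(x)x$. *Theorem.* Let $f\in L^1(\bar\Omega)$ with $f>0$ a.e., and let $\eta$ be a Radon measure on $\bar\Omega^*$. Let $a>0$ and $a'\ge \dfrac{4a}{\delta}$, and assume $$\int_{\bar\Omega}f(x)\,dx\ \ge\ \frac{1}{C(a',\delta)}\,\eta(\bar\Omega^*),\qquad C(a',\delta)=\frac{\delta^3}{2a'^2}.$$ Then for every $m_0\in\operatorname{supp}\eta$ there is a reflector $\sigma=\{\rho(x)x\}_{x\in\bar\Omega}$ from $\bar\Omega$ to $\bar\Omega^*$, belonging to $\mathcal A(a)$, with $a\le\rho(x)\le \dfrac{a'}{\delta}$ for all $x\in\bar\Omega$, such that $\nu_\rho(x)$ exists and is unique for a.e. $x\in\bar\Omega$ and, for every Borel set $E\subseteq\bar\Omega^*$, the set $\tau_\sigma(E)$ is Lebesgue measurable, $f(x)\,\dfrac{x\cdot\nu_\rho(x)}{\rho(x)^2}$ is integrable on it, $$\eta(E)\ \le\ \int_{\tau_\sigma(E)} f(x)\,\frac{x\cdot\nu_\rho(x)}{\rho(x)^2}\,dx,$$ and equality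 holds whenever $m_0\notin E$. -/

import Mathlib

open MeasureTheory Set Topology Asymptotics

noncomputable section

namespace FarField

/-- Three-dimensional Euclidean space; the source `O` is the origin. -/
abbrev E3 : Type := EuclideanSpace ℝ (Fin 3)

/-- The unit sphere of directions. -/
abbrev S2 : Type := Metric.sphere (0 : E3) 1

/-- The surface (area) measure on the unit sphere. -/
def surfaceMeasure : Measure S2 := (volume : Measure E3).toSphere

/-- The polar radius `x ↦ d / (1 - x · m)` of the paraboloid of revolution `P_d(m)` with focus at
the origin, axis direction `m` and focal parameter `d`. -/
def paraboloidRadius (d : ℝ) (m x : S2) : ℝ := d / (1 - inner ℝ (x : E3) (m : E3))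

/-- The surface `{ρ(x) x : x ∈ K}` with polar radius `ρ` over the set of directions `K`. -/
def polarSurface (K : Set S2) (ρ : S2 → ℝ) : Set E3 := (fun x : S2 => ρ x • (x : E3)) '' K

/-- `P_d(m)` (with `d > 0`) supports the surface `{ρ(x) x : x ∈ K}` at `ρ(x₀) x₀`. -/
def Supports (K : Set S2) (ρ : S2 → ℝ) (d : ℝ) (m x₀ : S2) : Prop :=
  0 < d ∧ (∀ x ∈ K, x ≠ m ∧ ρ x ≤ paraboloidRadius d m x) ∧ ρ x₀ = paraboloidRadius d m x₀

/-- `{ρ(x) x : x ∈ K}` is a reflector from `K` to the set of directions `T`. -/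
def IsReflector (K T : Set S2) (ρ : S2 → ℝ) : Prop :=
  ∀ x₀ ∈ K, ∃ m ∈ T, ∃ d : ℝ, Supports K ρ d m x₀

/-- The class `𝒜(a)` of reflectors from `K` to `T` that have at each of their points a supporting
paraboloid with focal parameter at least `2 a`. -/
def ReflectorClass (K T : Set S2) (a : ℝ) : Set (S2 → ℝ) :=
  {ρ | IsReflector K T ρ ∧ ∀ x₀ ∈ K, ∃ m ∈ T, ∃ d : ℝ, 2 * a ≤ d ∧ Supports K ρ d m x₀}

/-- The reflector mapping `𝒩_σ`. -/
def reflectorMap (K T : Set S2) (ρ : S2 → ℝ) (x₀ : S2) : Set S2 :=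
  {m | m ∈ T ∧ ∃ d : ℝ, Supports K ρ d m x₀}

/-- The tracing mapping `τ_σ` on sets: the directions of `K` that are reflected into `E`. -/
def tracing (K T : Set S2) (ρ : S2 → ℝ) (E : Set S2) : Set S2 :=
  {x | x ∈ K ∧ ∃ m ∈ E, m ∈ reflectorMap K T ρ x}

/-- `ν` is a unit normal to the set `S` at `p`: the plane through `p` orthogonal to `ν` is tangent
to `S` at `p`, that is `(q - p) · ν = o(|q - p|)` as `q → p` in `S`. -/
def IsUnitNormal (S : Set E3) (p ν : E3) : Prop :=
  ‖ν‖ = 1 ∧ (fun q : E3 => inner ℝ (q - p) ν) =o[𝓝[S] p] (fun q : E3 => q - p)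

/-- `ν` is an outer unit normal to `{ρ(x) x : x ∈ K}` at `ρ(x) x`: a unit normal pointing away from
the origin. -/
def IsOuterUnitNormal (K : Set S2) (ρ : S2 → ℝ) (x : S2) (ν : E3) : Prop :=
  IsUnitNormal (polarSurface K ρ) (ρ x • (x : E3)) ν ∧ 0 < inner ℝ (x : E3) ν

open scoped Classical in
/-- The outer unit normal `ν_ρ(x)` at `ρ(x) x` wherever there is exactly one (and `0` at the
remaining, singular points). -/
def outerNormal (K : Set S2) (ρ : S2 → ℝ) (x : S2) : E3 :=
  if h : ∃! ν : E3, IsOuterUnitNormal K ρ x ν then h.choose else 0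

/-- The density `f(x) (x · ν_ρ(x)) / ρ(x)²` of irradiance. -/
def irradiance (K : Set S2) (f ρ : S2 → ℝ) (x : S2) : ℝ :=
  f x * (inner ℝ (x : E3) (outerNormal K ρ x) / ρ x ^ 2)

end FarField

end

noncomputable section

open Filter TopologicalSpace
open scoped BoundedContinuousFunction

/-! In terms of `1/ρ`, a paraboloid with focus at the origin becomes the restriction to the sphere
of the convex one-homogeneous function `y ↦ (‖y‖ - y·m)/d`. Support from outside bounds `1/ρ` from
below, so a reflector is obtained by taking for `1/ρ` the maximum of these gauges over a compact
family `C` (`envelope`). This maximum is Lipschitz, hence differentiable almost everywhere, and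
where it is differentiable its gradient `(x - m)/d` determines both the touching paraboloid
(`eq_of_gauge_le_envelope`) and the normal. The factor `x·ν/ρ²` then becomes the explicit `weight`,
and the problem concerns the distribution of `f · weight` under the map from `x` to its optimal axis
(`flux`).

For finitely many directions (`exists_discrete_reflector`), fix the parameter `a'` at `m₀` and
minimise the sum of the focal parameters under the constraint that no other direction receives more
than prescribed. Lowering one parameter takes light away from the other directions
(`fluxAt_le_of_le`), so a slack constraint would contradict minimality. The presence of `(m₀, a')`
bounds the weight below by `δ³/(2a'²)`; the energy hypothesis then forces light into `m₀`, which
keeps every parameter at least `2a`.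

For general `η`, discretise. The families lie in a compact hyperspace, and the flux is continuous in
the family (`tendsto_flux`) because the optimal paraboloid is stable where it is unique. In the
limit the distribution is `η` plus a nonnegative multiple of the Dirac mass at `m₀`: hence the
inequality, with equality for sets avoiding `m₀`. -/

namespace FarField

/-! ### Gauges of paraboloids and their envelopes -/

/-- A paraboloid of revolution with focus at the origin, given by its axis direction and its focal
parameter. -/
abbrev Paraboloid : Type := S2 × ℝ

/-- The one-homogeneous extension to the whole space of the reciprocal polar radius of a
paraboloid. -/
def gauge (p : Paraboloid) (y : E3) : ℝ := (‖y‖ - inner ℝ y (p.1 : E3)) / p.2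

lemma gauge_sphere (p : Paraboloid) (x : S2) :
    gauge p x = (1 - inner ℝ (x : E3) (p.1 : E3)) / p.2 := by
  simp [gauge]

lemma paraboloidRadius_eq_inv_gauge (d : ℝ) (m x : S2) :
    paraboloidRadius d m x = (gauge (m, d) x)⁻¹ := by
  simp [paraboloidRadius, gauge_sphere]

lemma gauge_smul (p : Paraboloid) {t : ℝ} (ht : 0 ≤ t) (y : E3) :
    gauge p (t • y) = t * gauge p y := by
  simp only [gauge, norm_smul, inner_smul_left, Real.norm_of_nonneg ht]
  simp
  ring

lemma gauge_continuousAt {y : E3} {p : Paraboloid} (hp : 0 < p.2) :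
    ContinuousAt (fun z : E3 × Paraboloid => gauge z.2 z.1) (y, p) := by
  unfold gauge
  refine ContinuousAt.div ?_ (by fun_prop) hp.ne'
  fun_prop

lemma gauge_continuousAt_left {y : E3} {p : Paraboloid} (hp : 0 < p.2) :
    ContinuousAt (fun q : Paraboloid => gauge q y) p := by
  have := gauge_continuousAt (y := y) hp
  exact this.comp (f := fun q : Paraboloid => (y, q)) (by fun_prop)

lemma one_sub_inner_nonneg (x m : S2) : 0 ≤ 1 - inner ℝ (x : E3) (m : E3) := by
  have := real_inner_le_norm (x : E3) (m : E3)
  simp at this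
  linarith

lemma one_sub_inner_le_two (x m : S2) : 1 - inner ℝ (x : E3) (m : E3) ≤ 2 := by
  have := abs_real_inner_le_norm (x : E3) (m : E3)
  simp at this
  linarith [neg_le_of_abs_le this]

lemma gauge_le_add {a : ℝ} (ha : 0 < a) {p : Paraboloid} (hp : a ≤ p.2) (y z : E3) :
    gauge p y ≤ gauge p z + 2 / a * dist y z := by
  have h1 : ‖y‖ - ‖z‖ ≤ ‖y - z‖ := norm_sub_norm_le y z
  have h2 : inner ℝ (z - y) (p.1 : E3) ≤ ‖y - z‖ := by
    have := real_inner_le_norm (z - y) (p.1 : E3)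
    simpa [norm_sub_rev] using this
  rw [inner_sub_left] at h2
  have hp0 : 0 < p.2 := ha.trans_le hp
  have : gauge p y - gauge p z ≤ 2 * ‖y - z‖ / p.2 := by
    unfold gauge
    rw [← sub_div]
    gcongr
    linarith
  have h3 : 2 * ‖y - z‖ / p.2 ≤ 2 * ‖y - z‖ / a := by gcongr
  rw [dist_eq_norm]
  have h4 : 2 / a * ‖y - z‖ = 2 * ‖y - z‖ / a := by ring
  linarith

instance : Nonempty S2 := (NormedSpace.sphere_nonempty.2 zero_le_one).to_subtype

/-- A paraboloid of the family `C` whose gauge is maximal in the direction `y`, if there is one. -/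
def optimal (C : NonemptyCompacts Paraboloid) (y : E3) : Paraboloid :=
  Classical.epsilon fun p => p ∈ C ∧ ∀ q ∈ C, gauge q y ≤ gauge p y

/-- The largest gauge of the family `C`. -/
def envelope (C : NonemptyCompacts Paraboloid) (y : E3) : ℝ := gauge (optimal C y) y

variable {C : NonemptyCompacts Paraboloid} {a : ℝ}

lemma optimal_spec (ha : 0 < a) (hC : ∀ p ∈ C, a ≤ p.2) (y : E3) :
    optimal C y ∈ C ∧ ∀ q ∈ C, gauge q y ≤ gauge (optimal C y) y := by
  apply Classical.epsilon_spec (p := fun p => p ∈ C ∧ ∀ q ∈ C, gauge q y ≤ gauge p y)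
  obtain ⟨p, hp, hmax⟩ := C.isCompact.exists_isMaxOn C.nonempty
    (f := fun q : Paraboloid => gauge q y)
    fun q hq => (gauge_continuousAt_left (ha.trans_le (hC q hq))).continuousWithinAt
  exact ⟨p, hp, fun q hq => hmax hq⟩

lemma optimal_mem (ha : 0 < a) (hC : ∀ p ∈ C, a ≤ p.2) (y : E3) : optimal C y ∈ C :=
  (optimal_spec ha hC y).1

lemma gauge_le_envelope (ha : 0 < a) (hC : ∀ p ∈ C, a ≤ p.2) (y : E3) {q : Paraboloid}
    (hq : q ∈ C) : gauge q y ≤ envelope C y :=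
  (optimal_spec ha hC y).2 q hq

lemma envelope_smul (ha : 0 < a) (hC : ∀ p ∈ C, a ≤ p.2) {t : ℝ} (ht : 0 ≤ t) (y : E3) :
    envelope C (t • y) = t * envelope C y := by
  apply le_antisymm
  · rw [envelope, gauge_smul _ ht]
    exact mul_le_mul_of_nonneg_left (gauge_le_envelope ha hC y (optimal_mem ha hC _)) ht
  · rw [envelope, ← gauge_smul _ ht]
    exact gauge_le_envelope ha hC _ (optimal_mem ha hC _)

lemma envelope_lipschitz (ha : 0 < a) (hC : ∀ p ∈ C, a ≤ p.2) :
    LipschitzWith (Real.toNNReal (2 / a)) (envelope C) := by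
  apply LipschitzWith.of_le_add_mul
  intro y z
  rw [Real.coe_toNNReal _ (by positivity)]
  calc envelope C y ≤ gauge (optimal C y) z + 2 / a * dist y z :=
        gauge_le_add ha (hC _ (optimal_mem ha hC y)) y z
    _ ≤ _ := by gcongr; exact gauge_le_envelope ha hC z (optimal_mem ha hC y)

/-! ### Differentiability almost everywhere and uniqueness of the touching paraboloid -/

instance : IsFiniteMeasure surfaceMeasure := by unfold surfaceMeasure; infer_instance

lemma envelope_differentiableAt_smul (ha : 0 < a) (hC : ∀ p ∈ C, a ≤ p.2) {t : ℝ} (ht : 0 < t)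
    {y : E3} (h : DifferentiableAt ℝ (envelope C) (t • y)) :
    DifferentiableAt ℝ (envelope C) y := by
  have h2 : envelope C = fun z => t⁻¹ * envelope C (t • z) := by
    ext z
    rw [envelope_smul ha hC ht.le]
    field_simp
  rw [h2]
  apply DifferentiableAt.const_mul
  exact h.comp (f := fun z : E3 => t • z) y (by fun_prop)

/-- The surface measure of a set is a multiple of the volume of the cone over it. By homogeneity,
the cone over the bad directions consists of bad points, and these are null by Rademacher's theorem.
-/
lemma ae_envelope_differentiableAt (ha : 0 < a) (hC : ∀ p ∈ C, a ≤ p.2) :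
    ∀ᵐ x : S2 ∂surfaceMeasure, DifferentiableAt ℝ (envelope C) (x : E3) := by
  have hmeas : MeasurableSet {x : S2 | DifferentiableAt ℝ (envelope C) (x : E3)} :=
    measurable_subtype_coe (measurableSet_of_differentiableAt ℝ (envelope C))
  rw [ae_iff, surfaceMeasure, Measure.toSphere_apply' _ (by exact hmeas.compl), mul_eq_zero]
  right
  refine measure_mono_null ?_ (ae_iff.1 (envelope_lipschitz ha hC).ae_differentiableAt)
  rintro _ ⟨t, ht, _, ⟨x, hx, rfl⟩, rfl⟩ h
  exact hx (envelope_differentiableAt_smul ha hC ht.1 h)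

lemma hasFDerivAt_gauge (p : Paraboloid) (x : S2) :
    HasFDerivAt (gauge p) (innerSL ℝ (p.2⁻¹ • ((x : E3) - p.1))) (x : E3) := by
  have hx : (x : E3) ≠ 0 := by
    intro h
    have := norm_eq_of_mem_sphere x
    simp [h] at this
  have h1 : HasFDerivAt (fun y : E3 => ‖y‖) (innerSL ℝ (x : E3)) (x : E3) := by
    have := (hasStrictFDerivAt_norm_sq (x : E3)).hasFDerivAt.sqrt (by simp)
    simp only [norm_nonneg, Real.sqrt_sq, norm_eq_of_mem_sphere] at this
    refine this.congr_fderiv ?_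
    ext v
    simp
  have h2 : HasFDerivAt (fun y : E3 => inner ℝ y (p.1 : E3)) (innerSL ℝ (p.1 : E3)) (x : E3) := by
    refine (innerSL ℝ (p.1 : E3)).hasFDerivAt.congr_of_eventuallyEq (.of_forall fun y => ?_)
    simp [real_inner_comm]
  have h3 := (h1.sub h2).mul_const p.2⁻¹
  refine (h3.congr_fderiv ?_).congr_of_eventuallyEq (.of_forall fun y => ?_)
  · ext v
    simp
  · simp [gauge, div_eq_mul_inv]

/-- A paraboloid touching the graph of a differentiable function from below determines its
derivative. -/
lemma hasFDerivAt_of_gauge_le {u : E3 → ℝ} {x : S2} (hu : DifferentiableAt ℝ u (x : E3))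
    {p : Paraboloid} (hle : ∀ᶠ y in 𝓝 (x : E3), gauge p y ≤ u y) (heq : gauge p x = u x) :
    HasFDerivAt u (innerSL ℝ (p.2⁻¹ • ((x : E3) - p.1))) (x : E3) := by
  have h := hu.hasFDerivAt.sub (hasFDerivAt_gauge p x)
  have hmin : IsLocalMin (fun y => u y - gauge p y) (x : E3) := by
    filter_upwards [hle] with y hy
    linarith
  have h0 := hmin.hasFDerivAt_eq_zero h
  rw [sub_eq_zero] at h0
  rw [← h0]
  exact hu.hasFDerivAt

/-- The point `m` lies on the line through `x` and `m' ≠ x`, which meets the sphere only in these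
two points; positivity of `d / d'` excludes `m = x`. -/
lemma axis_eq_of_smul_sub_eq {x m m' : S2} {d d' : ℝ} (hd : 0 < d) (hd' : 0 < d')
    (hm : inner ℝ (x : E3) (m' : E3) < 1)
    (h : d⁻¹ • ((x : E3) - m) = d'⁻¹ • ((x : E3) - m')) : (m, d) = (m', d') := by
  have h1 : (m : E3) = x - (d / d') • ((x : E3) - m') := by
    have : (x : E3) - m = (d / d') • ((x : E3) - m') := by
      rw [div_eq_mul_inv, mul_smul, ← h, smul_smul, mul_inv_cancel₀ hd.ne', one_smul]
    rw [← this]; abel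
  set t := d / d' with ht
  have ht0 : 0 < t := by positivity
  have h2 : ‖(m : E3)‖ ^ 2 = 1 - 2 * t * (1 - inner ℝ (x : E3) (m' : E3))
      + t ^ 2 * (2 * (1 - inner ℝ (x : E3) (m' : E3))) := by
    rw [h1, norm_sub_sq_real, norm_smul, mul_pow, norm_sub_sq_real, inner_smul_right,
      inner_sub_right]
    simp
    ring
  have h3 : t = 1 := by
    have : t * (t - 1) * (1 - inner ℝ (x : E3) (m' : E3)) = 0 := by
      simp at h2
      nlinarith
    have h4 : (1 - inner ℝ (x : E3) (m' : E3)) ≠ 0 := by linarith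
    have h5 : t - 1 = 0 := by
      simpa [ht0.ne', h4] using this
    linarith
  have hdd : d = d' := by
    rw [ht, div_eq_one_iff_eq hd'.ne'] at h3
    exact h3
  rw [h3] at h1
  simp only [one_smul, sub_sub_cancel] at h1
  exact Prod.ext (Subtype.ext h1) hdd

/-- At a point of differentiability of the envelope, the touching paraboloid is unique. -/
lemma eq_of_gauge_le_envelope {x : S2} (hu : DifferentiableAt ℝ (envelope C) (x : E3))
    {p q : Paraboloid} (hp : 0 < p.2) (hq : 0 < q.2)
    (hx : inner ℝ (x : E3) (q.1 : E3) < 1)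
    (hple : ∀ᶠ y in 𝓝 (x : E3), gauge p y ≤ envelope C y) (hpeq : gauge p x = envelope C x)
    (hqle : ∀ᶠ y in 𝓝 (x : E3), gauge q y ≤ envelope C y) (hqeq : gauge q x = envelope C x) :
    p = q := by
  have h := (hasFDerivAt_of_gauge_le hu hple hpeq).unique (hasFDerivAt_of_gauge_le hu hqle hqeq)
  exact axis_eq_of_smul_sub_eq hp hq hx ((innerSL_inj (𝕜 := ℝ)).1 h)

lemma optimal_unique (ha : 0 < a) (hC : ∀ p ∈ C, a ≤ p.2) {x : S2}
    (hu : DifferentiableAt ℝ (envelope C) (x : E3))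
    (hx : ∀ p ∈ C, inner ℝ (x : E3) (p.1 : E3) < 1) {q : Paraboloid} (hq : q ∈ C)
    (hmax : ∀ p ∈ C, gauge p x ≤ gauge q x) : q = optimal C x := by
  have ho := optimal_mem ha hC x
  refine eq_of_gauge_le_envelope hu (ha.trans_le (hC _ hq)) (ha.trans_le (hC _ ho)) (hx _ ho)
    (.of_forall fun y => gauge_le_envelope ha hC y hq) ?_
    (.of_forall fun y => gauge_le_envelope ha hC y ho) rfl
  exact le_antisymm (gauge_le_envelope ha hC _ hq) (hmax _ ho)

/-! ### Stability of the optimal paraboloid -/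

/-- The optimal paraboloid depends continuously on the direction and on the family wherever it is
unique. -/
lemma tendsto_optimal {ι : Type*} {l : Filter ι} {B : Set Paraboloid} (hB : IsCompact B)
    (ha : 0 < a) (hBa : ∀ p ∈ B, a ≤ p.2) {Ck : ι → NonemptyCompacts Paraboloid}
    (hCk : ∀ᶠ k in l, (Ck k : Set Paraboloid) ⊆ B) (hlim : Tendsto Ck l (𝓝 C))
    {yk : ι → E3} {y : E3} (hy : Tendsto yk l (𝓝 y)) (hC : ∀ p ∈ C, a ≤ p.2)
    (huniq : ∀ q ∈ C, (∀ p ∈ C, gauge p y ≤ gauge q y) → q = optimal C y) :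
    Tendsto (fun k => optimal (Ck k) (yk k)) l (𝓝 (optimal C y)) := by
  have hopt : ∀ᶠ k in l, optimal (Ck k) (yk k) ∈ Ck k ∧
      ∀ q ∈ Ck k, gauge q (yk k) ≤ gauge (optimal (Ck k) (yk k)) (yk k) := by
    filter_upwards [hCk] with k hk
    exact optimal_spec ha (fun p hp => hBa p (hk hp)) _
  -- By compactness of `B` it is enough that every cluster point `p` of the optimal paraboloids is a
  -- maximiser in `C`.
  refine hB.tendsto_nhds_of_unique_mapClusterPt ?_ ?_
  · filter_upwards [hCk, hopt] with k hk hk' using hk hk'.1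
  intro p hpB hp
  have hpos : 0 < p.2 := ha.trans_le (hBa p hpB)
  have hpC : p ∈ C := by
    by_contra hpC
    have hnhds : (C : Set Paraboloid)ᶜ ∈ 𝓝 p := C.isCompact.isClosed.isOpen_compl.mem_nhds hpC
    obtain ⟨V, hV, hVc, hVs⟩ := exists_mem_nhds_isClosed_subset hnhds
    have h1 : ∀ᶠ k in l, (Ck k : Set Paraboloid) ⊆ Vᶜ :=
      hlim.eventually ((NonemptyCompacts.isOpen_subsets_of_isOpen hVc.isOpen_compl).mem_nhds
        (fun q hq hqV => hVs hqV hq))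
    obtain ⟨k, hk, hk1, hk2⟩ := ((hp.frequently hV).and_eventually (h1.and hopt)).exists
    exact hk1 hk2.1 hk
  refine huniq p hpC fun q hq => ?_
  -- If some `q` in `C` beat `p` strictly, then for suitable `k` a member of `Ck k` close to `q`
  -- would beat the optimal one, which is close to `p`.
  by_contra! hlt
  obtain ⟨r, hr1, hr2⟩ := exists_between hlt
  have hp' : ∀ᶠ z in 𝓝 y ×ˢ 𝓝 p, gauge z.2 z.1 < r := by
    rw [← nhds_prod_eq]
    exact (gauge_continuousAt hpos).eventually_lt_const hr1
  have hq' : ∀ᶠ z in 𝓝 y ×ˢ 𝓝 q, r < gauge z.2 z.1 := by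
    rw [← nhds_prod_eq]
    exact (gauge_continuousAt (ha.trans_le (hC q hq))).eventually_const_lt hr2
  obtain ⟨P1, hP1, P2, hP2, hP⟩ := eventually_prod_iff.1 hp'
  obtain ⟨Q1, hQ1, Q2, hQ2, hQ⟩ := eventually_prod_iff.1 hq'
  obtain ⟨W, hWQ, hWo, hqW⟩ := mem_nhds_iff.1 hQ2
  have h2 : ∀ᶠ k in l, ((Ck k : Set Paraboloid) ∩ W).Nonempty :=
    hlim.eventually ((NonemptyCompacts.isOpen_inter_nonempty_of_isOpen hWo).mem_nhds ⟨q, hq, hqW⟩)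
  obtain ⟨k, hk, hk0, hk1, hk2, s, hs1, hs2⟩ :=
    ((hp.frequently hP2).and_eventually
      (hopt.and ((hy.eventually hP1).and ((hy.eventually hQ1).and h2)))).exists
  have := hk0.2 s hs1
  linarith [hP hk1 hk, hQ hk2 (hWQ hs2)]

/-! ### Normals to the level surface of a one-homogeneous function -/

lemma coe_sphere_ne_zero (x : S2) : (x : E3) ≠ 0 := by
  intro h
  have := norm_eq_of_mem_sphere x
  simp [h] at this

/-- Carries information known only over `K` to a full neighbourhood in space, as derivative
arguments require; this is why interior points of `K` are singled out. -/
lemma eventually_mem_cone {K : Set S2} {x : S2} (hx : x ∈ interior K) {t : ℝ} (ht : 0 < t) :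
    ∀ᶠ y in 𝓝 (t • (x : E3)), ∃ s : ℝ, 0 < s ∧ ∃ z ∈ K, y = s • (z : E3) := by
  obtain ⟨V, hV, hVK⟩ := isOpen_induced_iff.1 (isOpen_interior (s := K))
  have hne : t • (x : E3) ≠ 0 := smul_ne_zero ht.ne' (coe_sphere_ne_zero x)
  have hcont : ContinuousAt (fun y : E3 => ‖y‖⁻¹ • y) (t • (x : E3)) :=
    ContinuousAt.smul (ContinuousAt.inv₀ (by fun_prop) (norm_ne_zero_iff.2 hne)) continuousAt_id
  have hval : ‖t • (x : E3)‖⁻¹ • (t • (x : E3)) = x := by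
    rw [norm_smul, smul_smul]
    simp [abs_of_pos ht, ht.ne']
  have hxV : (x : E3) ∈ V := by
    have : x ∈ Subtype.val ⁻¹' V := hVK ▸ hx
    exact this
  have h1 : ∀ᶠ y in 𝓝 (t • (x : E3)), ‖y‖⁻¹ • y ∈ V :=
    hcont.eventually_mem (hV.mem_nhds (by rw [hval]; exact hxV))
  filter_upwards [h1, isOpen_ne.mem_nhds hne] with y hy hy0
  have hy0' : 0 < ‖y‖ := norm_pos_iff.2 hy0
  refine ⟨‖y‖, hy0', ⟨‖y‖⁻¹ • y, ?_⟩, ?_, ?_⟩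
  · simp [norm_smul, hy0'.ne']
  · apply interior_subset (s := K)
    rw [← hVK]
    exact hy
  · rw [smul_smul, mul_inv_cancel₀ hy0'.ne', one_smul]

lemma hasFDerivAt_smul_of_homogeneous {u : E3 → ℝ} (hom : ∀ t > 0, ∀ y, u (t • y) = t * u y)
    {L : E3 →L[ℝ] ℝ} {y : E3} (h : HasFDerivAt u L y) {t : ℝ} (ht : 0 < t) :
    HasFDerivAt u L (t • y) := by
  have h1 : HasFDerivAt (fun z : E3 => t⁻¹ • z) (t⁻¹ • ContinuousLinearMap.id ℝ E3) (t • y) :=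
    (hasFDerivAt_id (𝕜 := ℝ) (t • y)).const_smul t⁻¹
  have h2 : HasFDerivAt u L (t⁻¹ • (t • y)) := by
    rwa [smul_smul, inv_mul_cancel₀ ht.ne', one_smul]
  have h3 := (h2.comp (t • y) h1).const_mul t
  refine (h3.congr_fderiv ?_).congr_of_eventuallyEq (.of_forall fun z => ?_)
  · ext v
    simp [ht.ne']
  · change u z = t * u (t⁻¹ • z)
    rw [← hom t ht, smul_smul, mul_inv_cancel₀ ht.ne', one_smul]

section Normal

variable {u : E3 → ℝ} {K : Set S2} {x : S2} {v : E3}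

lemma apply_eq_one_of_mem_polarSurface (hom : ∀ t > 0, ∀ y, u (t • y) = t * u y)
    (hpos : ∀ z ∈ K, 0 < u (z : E3)) {q : E3}
    (hq : q ∈ polarSurface K fun z => (u (z : E3))⁻¹) : u q = 1 := by
  obtain ⟨z, hz, rfl⟩ := hq
  simp only
  rw [hom _ (inv_pos.2 (hpos z hz)), inv_mul_cancel₀ (hpos z hz).ne']

/-- The surface lies in the level set `u = 1`, so the first-order expansion of `u` along it has no
increment and leaves `v · (q - p) = o(|q - p|)`. -/
lemma isOuterUnitNormal_of_hasFDerivAt (hom : ∀ t > 0, ∀ y, u (t • y) = t * u y)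
    (hpos : ∀ z ∈ K, 0 < u (z : E3)) (hx : x ∈ K) (hv : 0 < inner ℝ (x : E3) v)
    (hd : HasFDerivAt u (innerSL ℝ v) (x : E3)) :
    IsOuterUnitNormal K (fun z => (u (z : E3))⁻¹) x (‖v‖⁻¹ • v) := by
  have hv0 : v ≠ 0 := by rintro rfl; simp at hv
  have hvn : 0 < ‖v‖ := norm_pos_iff.2 hv0
  refine ⟨⟨by simp [norm_smul, hvn.ne'], ?_⟩, ?_⟩
  · have h1 := (hasFDerivAt_smul_of_homogeneous hom hd (inv_pos.2 (hpos x hx))).isLittleO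
    have h2 := (h1.mono (nhdsWithin_le_nhds
      (s := polarSurface K fun z => (u (z : E3))⁻¹))).const_mul_left (-‖v‖⁻¹)
    refine h2.congr' ?_ EventuallyEq.rfl
    filter_upwards [self_mem_nhdsWithin] with q hq
    rw [apply_eq_one_of_mem_polarSurface hom hpos hq, hom _ (inv_pos.2 (hpos x hx)),
      inv_mul_cancel₀ (hpos x hx).ne']
    rw [inner_smul_right, innerSL_apply_apply, real_inner_comm]
    ring
  · rw [inner_smul_right]
    positivity

/-- Every `w ⊥ v` is the velocity of a curve in the surface: project the line `p + t w` radially.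
The scaling factor is stationary at `t = 0` because the derivative of `u` in the direction `w`
vanishes. -/
lemma inner_eq_zero_of_isUnitNormal (hom : ∀ t > 0, ∀ y, u (t • y) = t * u y)
    (hpos : ∀ z ∈ K, 0 < u (z : E3)) (hx : x ∈ interior K)
    (hd : HasFDerivAt u (innerSL ℝ v) (x : E3)) {ν : E3}
    (hν : IsUnitNormal (polarSurface K fun z => (u (z : E3))⁻¹) ((u (x : E3))⁻¹ • (x : E3)) ν)
    {w : E3} (hw : inner ℝ v w = 0) : inner ℝ w ν = 0 := by
  have hux : 0 < u (x : E3) := hpos x (interior_subset hx)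
  set p : E3 := (u (x : E3))⁻¹ • (x : E3) with hp
  have hup : u p = 1 := by
    rw [hp, hom _ (inv_pos.2 hux), inv_mul_cancel₀ hux.ne']
  have hline : HasDerivAt (fun t : ℝ => p + t • w) w 0 := by
    simpa using ((hasDerivAt_id (0 : ℝ)).smul_const w).const_add p
  have h0 : p + (0 : ℝ) • w = p := by simp
  have hdp : HasFDerivAt u (innerSL ℝ v) (p + (0 : ℝ) • w) := by
    rw [h0]
    exact hasFDerivAt_smul_of_homogeneous hom hd (inv_pos.2 hux)
  have hu' : HasDerivAt (fun t : ℝ => u (p + t • w)) 0 0 := by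
    have := hdp.comp_hasDerivAt (0 : ℝ) hline
    simpa [hw, Function.comp_def] using this
  let γ : ℝ → E3 := fun t => (u (p + t • w))⁻¹ • (p + t • w)
  have hγ0 : γ 0 = p := by simp [γ, hup]
  have hγ : HasDerivAt γ w 0 :=
    ((hu'.fun_inv (by rw [h0, hup]; exact one_ne_zero)).fun_smul hline).congr_deriv
      (by simp [hup])
  have hmem : ∀ᶠ t in 𝓝 (0 : ℝ), γ t ∈ polarSurface K fun z => (u (z : E3))⁻¹ := by
    have hc : Tendsto (fun t : ℝ => p + t • w) (𝓝 0) (𝓝 p) := by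
      have := hline.continuousAt.tendsto
      rwa [h0] at this
    filter_upwards [hc.eventually (eventually_mem_cone hx (inv_pos.2 hux))] with t ht
    obtain ⟨s, hs, z, hz, hsz⟩ := ht
    refine ⟨z, hz, ?_⟩
    simp only [γ]
    rw [hsz, hom _ hs, smul_smul]
    congr 1
    field_simp
  have htend : Tendsto γ (𝓝 0) (𝓝[polarSurface K fun z => (u (z : E3))⁻¹] p) := by
    refine tendsto_nhdsWithin_iff.2 ⟨?_, hmem⟩
    have := hγ.continuousAt.tendsto
    rwa [hγ0] at this
  have hlo : (fun t : ℝ => inner ℝ (γ t - p) ν) =o[𝓝 0] fun t : ℝ => t := by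
    have h1 := hν.2.comp_tendsto htend
    refine h1.trans_isBigO ?_
    have := hγ.isBigO_sub
    simpa [hγ0, Function.comp_def] using this
  have h1 : HasDerivAt (fun t : ℝ => inner ℝ (γ t - p) ν) 0 0 := by
    rw [hasDerivAt_iff_isLittleO]
    simpa [hγ0] using hlo
  have h2 : HasDerivAt (fun t : ℝ => inner ℝ (γ t - p) ν) (inner ℝ w ν) 0 := by
    have := (hγ.sub_const p).inner ℝ (hasDerivAt_const (0 : ℝ) ν)
    simpa using this
  exact h2.unique h1

lemma isOuterUnitNormal_iff (hom : ∀ t > 0, ∀ y, u (t • y) = t * u y)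
    (hpos : ∀ z ∈ K, 0 < u (z : E3)) (hx : x ∈ interior K) (hv : 0 < inner ℝ (x : E3) v)
    (hd : HasFDerivAt u (innerSL ℝ v) (x : E3)) (ν : E3) :
    IsOuterUnitNormal K (fun z => (u (z : E3))⁻¹) x ν ↔ ν = ‖v‖⁻¹ • v := by
  have hv0 : v ≠ 0 := by rintro rfl; simp at hv
  have hvn : 0 < ‖v‖ := norm_pos_iff.2 hv0
  refine ⟨fun h => ?_, fun h => h ▸
    isOuterUnitNormal_of_hasFDerivAt hom hpos (interior_subset hx) hv hd⟩
  -- `c • v` is the orthogonal projection of `ν` on the line of `v`; the remainder is tangent, hence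
  -- orthogonal to `ν` and to `v`, hence zero.
  set c : ℝ := inner ℝ v ν / ‖v‖ ^ 2 with hc
  have hw : inner ℝ v (ν - c • v) = 0 := by
    rw [inner_sub_right, inner_smul_right, real_inner_self_eq_norm_sq, hc]
    field_simp
    ring
  have hw2 := inner_eq_zero_of_isUnitNormal hom hpos hx hd h.1 hw
  have hw3 : ν - c • v = 0 := by
    rw [← inner_self_eq_zero (𝕜 := ℝ), inner_sub_right, hw2, inner_smul_right, real_inner_comm, hw]
    simp
  have hν : ν = c • v := sub_eq_zero.1 hw3
  have hcpos : 0 < c := by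
    have := h.2
    rw [hν, inner_smul_right] at this
    exact pos_of_mul_pos_left this hv.le
  have hnorm := h.1.1
  rw [hν, norm_smul, Real.norm_of_nonneg hcpos.le] at hnorm
  rw [hν, eq_inv_of_mul_eq_one_left hnorm]

end Normal

/-! ### Geometry of the reflector defined by an envelope -/

/-- The ratio between irradiance and emitted density for light sent from `x` to the axis direction
of the paraboloid `p`. -/
def weight (p : Paraboloid) (x : S2) : ℝ :=
  √((1 - inner ℝ (x : E3) (p.1 : E3)) / 2) * gauge p x ^ 2

section Envelope

variable {C : NonemptyCompacts Paraboloid} {a δ : ℝ} {K T : Set S2} {x : S2}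

lemma envelope_pos (ha : 0 < a) (hC : ∀ p ∈ C, a ≤ p.2)
    (hx : ∀ p ∈ C, inner ℝ (x : E3) (p.1 : E3) < 1) : 0 < envelope C x := by
  have ho := optimal_mem ha hC x
  rw [envelope, gauge_sphere]
  exact div_pos (by linarith [hx _ ho]) (ha.trans_le (hC _ ho))

lemma isOuterUnitNormal_envelope_iff (ha : 0 < a) (hC : ∀ p ∈ C, a ≤ p.2)
    (hK : ∀ z ∈ K, ∀ p ∈ C, inner ℝ (z : E3) (p.1 : E3) < 1) (hx : x ∈ interior K)
    (hd : DifferentiableAt ℝ (envelope C) (x : E3)) (ν : E3) :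
    IsOuterUnitNormal K (fun z => (envelope C z)⁻¹) x ν ↔
      ν = ‖(x : E3) - (optimal C x).1‖⁻¹ • ((x : E3) - (optimal C x).1) := by
  have ho := optimal_mem ha hC x
  have hpos : 0 < (optimal C x).2 := ha.trans_le (hC _ ho)
  have hgap := hK x (interior_subset hx) _ ho
  rw [isOuterUnitNormal_iff (fun t ht y => envelope_smul ha hC ht.le y)
    (fun z hz => envelope_pos ha hC (hK z hz)) hx ?_ (hasFDerivAt_of_gauge_le hd
    (.of_forall fun y => gauge_le_envelope ha hC y ho) rfl)]
  · rw [norm_smul, Real.norm_of_nonneg (inv_nonneg.2 hpos.le), smul_smul, mul_inv, inv_inv,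
      mul_right_comm, mul_inv_cancel₀ hpos.ne', one_mul]
  · rw [inner_smul_right, inner_sub_right]
    simp only [real_inner_self_eq_norm_sq, norm_eq_of_mem_sphere]
    have := inv_pos.2 hpos
    refine mul_pos this (by linarith)

lemma existsUnique_isOuterUnitNormal (ha : 0 < a) (hC : ∀ p ∈ C, a ≤ p.2)
    (hK : ∀ z ∈ K, ∀ p ∈ C, inner ℝ (z : E3) (p.1 : E3) < 1) (hx : x ∈ interior K)
    (hd : DifferentiableAt ℝ (envelope C) (x : E3)) :
    ∃! ν : E3, IsOuterUnitNormal K (fun z => (envelope C z)⁻¹) x ν :=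
  ⟨_, (isOuterUnitNormal_envelope_iff ha hC hK hx hd _).2 rfl,
    fun _ h => (isOuterUnitNormal_envelope_iff ha hC hK hx hd _).1 h⟩

/-- With `c = 1 - x·m` one has `|x - m|² = 2c` and `x·(x - m) = c`, so `x·ν = c/√(2c) = √(c/2)`. -/
lemma irradiance_envelope (ha : 0 < a) (hC : ∀ p ∈ C, a ≤ p.2)
    (hK : ∀ z ∈ K, ∀ p ∈ C, inner ℝ (z : E3) (p.1 : E3) < 1) (hx : x ∈ interior K)
    (hd : DifferentiableAt ℝ (envelope C) (x : E3)) (f : S2 → ℝ) :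
    irradiance K f (fun z => (envelope C z)⁻¹) x = f x * weight (optimal C x) x := by
  have hex := existsUnique_isOuterUnitNormal ha hC hK hx hd
  have hn : outerNormal K (fun z => (envelope C z)⁻¹) x =
      ‖(x : E3) - (optimal C x).1‖⁻¹ • ((x : E3) - (optimal C x).1) := by
    rw [outerNormal, dif_pos hex]
    exact (isOuterUnitNormal_envelope_iff ha hC hK hx hd _).1 hex.choose_spec.1
  have hgap := hK x (interior_subset hx) _ (optimal_mem ha hC x)
  set c : ℝ := 1 - inner ℝ (x : E3) ((optimal C x).1 : E3) with hc
  have hc0 : 0 < c := by linarith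
  have hnorm : ‖(x : E3) - (optimal C x).1‖ = √(2 * c) := by
    rw [eq_comm, Real.sqrt_eq_iff_mul_self_eq (by positivity) (norm_nonneg _), ← sq,
      norm_sub_sq_real]
    simp only [norm_eq_of_mem_sphere]
    ring
  have hinner : inner ℝ (x : E3) ((x : E3) - (optimal C x).1) = c := by
    rw [inner_sub_right, real_inner_self_eq_norm_sq]
    simp [hc]
  rw [irradiance, hn, inner_smul_right, hinner, hnorm, weight, ← hc, inv_pow, div_inv_eq_mul,
    envelope]
  congr 2
  rw [eq_comm, Real.sqrt_eq_iff_mul_self_eq (by positivity) (by positivity), mul_mul_mul_comm,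
    ← mul_inv, Real.mul_self_sqrt (by positivity)]
  field_simp

lemma supports_optimal (ha : 0 < a) (hC : ∀ p ∈ C, a ≤ p.2)
    (hK : ∀ z ∈ K, ∀ p ∈ C, inner ℝ (z : E3) (p.1 : E3) < 1) (x : S2) :
    Supports K (fun z => (envelope C z)⁻¹) (optimal C x).2 (optimal C x).1 x := by
  have ho := optimal_mem ha hC x
  have hpos : 0 < (optimal C x).2 := ha.trans_le (hC _ ho)
  refine ⟨hpos, fun z hz => ⟨?_, ?_⟩, ?_⟩
  · rintro h
    have := hK z hz _ ho
    rw [← h] at this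
    simp at this
  · rw [paraboloidRadius_eq_inv_gauge]
    refine inv_anti₀ ?_ (gauge_le_envelope ha hC _ ho)
    rw [gauge_sphere]
    exact div_pos (by linarith [hK z hz _ ho]) hpos
  · rw [paraboloidRadius_eq_inv_gauge]
    rfl

/-- A supporting paraboloid need not belong to `C`, but over an interior point its gauge still
touches the envelope from below near `x`, so the gradient identifies it. -/
lemma eq_optimal_of_supports (ha : 0 < a) (hC : ∀ p ∈ C, a ≤ p.2)
    (hK : ∀ z ∈ K, ∀ p ∈ C, inner ℝ (z : E3) (p.1 : E3) < 1) (hx : x ∈ interior K)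
    (hd : DifferentiableAt ℝ (envelope C) (x : E3)) {m : S2} {d : ℝ}
    (h : Supports K (fun z => (envelope C z)⁻¹) d m x) : (m, d) = optimal C x := by
  have ho := optimal_mem ha hC x
  refine eq_of_gauge_le_envelope hd h.1 (ha.trans_le (hC _ ho))
    (hK x (interior_subset hx) _ ho) ?_ ?_ (.of_forall fun y => gauge_le_envelope ha hC y ho) rfl
  · have := eventually_mem_cone hx one_pos
    rw [one_smul] at this
    filter_upwards [this] with y hy
    obtain ⟨s, hs, z, hz, rfl⟩ := hy
    rw [gauge_smul _ hs.le, envelope_smul ha hC hs.le]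
    refine mul_le_mul_of_nonneg_left ?_ hs.le
    have h1 := (h.2.1 z hz).2
    rw [paraboloidRadius_eq_inv_gauge] at h1
    have h2 := envelope_pos ha hC (hK z hz)
    exact (inv_le_inv₀ h2 (inv_pos.1 ((inv_pos.2 h2).trans_le h1))).1 h1
  · have := h.2.2
    rw [paraboloidRadius_eq_inv_gauge] at this
    exact (inv_injective this).symm

lemma mem_tracing_iff (ha : 0 < a) (hC : ∀ p ∈ C, a ≤ p.2) (hCT : ∀ p ∈ C, p.1 ∈ T)
    (hK : ∀ z ∈ K, ∀ p ∈ C, inner ℝ (z : E3) (p.1 : E3) < 1) (hx : x ∈ interior K)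
    (hd : DifferentiableAt ℝ (envelope C) (x : E3)) (E : Set S2) :
    x ∈ tracing K T (fun z => (envelope C z)⁻¹) E ↔ (optimal C x).1 ∈ E := by
  constructor
  · rintro ⟨-, m, hm, -, d, hs⟩
    rw [← eq_optimal_of_supports ha hC hK hx hd hs]
    exact hm
  · exact fun h => ⟨interior_subset hx, _, h, hCT _ (optimal_mem ha hC x), _,
      supports_optimal ha hC hK x⟩

end Envelope

/-! ### Measurability and continuity of the energy distribution -/

section Flux

variable {C : NonemptyCompacts Paraboloid} {a β : ℝ} {K T : Set S2} {f φ : S2 → ℝ} {M : ℝ}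

lemma ae_mem_and_differentiableAt (ha : 0 < a) (hC : ∀ p ∈ C, a ≤ p.2) (hK : IsClosed K) :
    ∀ᵐ x : S2 ∂surfaceMeasure.restrict K,
      x ∈ K ∧ DifferentiableAt ℝ (envelope C) (x : E3) := by
  filter_upwards [ae_restrict_mem hK.measurableSet,
    ae_restrict_of_ae (ae_envelope_differentiableAt ha hC)] with x h1 h2 using ⟨h1, h2⟩

lemma tendsto_optimal_of_differentiableAt {ι : Type*} {l : Filter ι} (ha : 0 < a)
    (hT : IsCompact T) (hsep : ∀ x ∈ K, ∀ m ∈ T, inner ℝ (x : E3) (m : E3) < 1)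
    (hC : (C : Set Paraboloid) ⊆ T ×ˢ Icc a β) {Ck : ι → NonemptyCompacts Paraboloid}
    (hCk : ∀ᶠ k in l, (Ck k : Set Paraboloid) ⊆ T ×ˢ Icc a β) (hlim : Tendsto Ck l (𝓝 C))
    {x : S2} (hx : x ∈ K) (hd : DifferentiableAt ℝ (envelope C) (x : E3)) {xk : ι → S2}
    (hxk : Tendsto xk l (𝓝 x)) :
    Tendsto (fun k => optimal (Ck k) (xk k)) l (𝓝 (optimal C x)) := by
  have hC' : ∀ p ∈ C, a ≤ p.2 := fun p hp => (hC hp).2.1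
  exact tendsto_optimal (hT.prod isCompact_Icc) ha (fun p hp => hp.2.1) hCk hlim
    ((continuous_subtype_val.tendsto x).comp hxk) hC' fun q hq hmax =>
      optimal_unique ha hC' hd (fun p hp => hsep x hx _ (hC hp).1) hq hmax

/-- `optimal` is an arbitrary choice, yet it is continuous on the set of differentiability points in
`K`, which has full measure in `K`. -/
lemma aemeasurable_optimal (ha : 0 < a) (hK : IsClosed K) (hT : IsCompact T)
    (hsep : ∀ x ∈ K, ∀ m ∈ T, inner ℝ (x : E3) (m : E3) < 1)
    (hC : (C : Set Paraboloid) ⊆ T ×ˢ Icc a β) :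
    AEMeasurable (fun x : S2 => optimal C x) (surfaceMeasure.restrict K) := by
  have hmeas : MeasurableSet {x : S2 | DifferentiableAt ℝ (envelope C) (x : E3)} :=
    measurable_subtype_coe (measurableSet_of_differentiableAt ℝ (envelope C))
  have hC' : ∀ p ∈ C, a ≤ p.2 := fun p hp => (hC hp).2.1
  have hcont : ContinuousOn (fun x : S2 => optimal C x)
      (K ∩ {x : S2 | DifferentiableAt ℝ (envelope C) (x : E3)}) := by
    intro x hx
    exact tendsto_optimal_of_differentiableAt ha hT hsep hC (.of_forall fun _ => hC)
      tendsto_const_nhds hx.1 hx.2 (tendsto_id.mono_left nhdsWithin_le_nhds)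
  have h := hcont.aemeasurable (μ := surfaceMeasure) (hK.measurableSet.inter hmeas)
  rwa [Measure.restrict_congr_set] at h
  refine inter_ae_eq_left_of_ae_eq_univ ?_
  rw [ae_eq_univ]
  exact ae_iff.1 (ae_envelope_differentiableAt ha hC')

lemma weight_nonneg (p : Paraboloid) (x : S2) : 0 ≤ weight p x := by
  unfold weight
  positivity

lemma weight_le (ha : 0 < a) {p : Paraboloid} (hp : a ≤ p.2) (x : S2) :
    weight p x ≤ (2 / a) ^ 2 := by
  have h1 := one_sub_inner_nonneg x p.1
  have h2 := one_sub_inner_le_two x p.1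
  have h3 : √((1 - inner ℝ (x : E3) (p.1 : E3)) / 2) ≤ 1 := by
    rw [Real.sqrt_le_iff]
    constructor <;> linarith
  have h4 : 0 ≤ gauge p x := by
    rw [gauge_sphere]
    exact div_nonneg h1 (ha.le.trans hp)
  have h5 : gauge p x ≤ 2 / a := by
    rw [gauge_sphere]
    gcongr
  calc weight p x ≤ 1 * (2 / a) ^ 2 := by
        unfold weight
        gcongr
    _ = _ := one_mul _

/-- The optimal gauge dominates that of `(m₀, a')`, which is at least `δ / a'`; the square root is
bounded below crudely by `δ / 2`. -/
lemma le_weight_optimal {δ a' : ℝ} (hδ : 0 < δ) (hδ1 : δ < 1) (ha' : 0 < a') (ha : 0 < a)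
    (hC : ∀ p ∈ C, a ≤ p.2) {x : S2}
    (hx : ∀ p ∈ C, inner ℝ (x : E3) (p.1 : E3) ≤ 1 - δ) {m₀ : S2} (hm₀ : (m₀, a') ∈ C) :
    δ ^ 3 / (2 * a' ^ 2) ≤ weight (optimal C x) x := by
  have h1 : δ / a' ≤ gauge (optimal C x) x := by
    refine le_trans ?_ ((optimal_spec ha hC x).2 _ hm₀)
    rw [gauge_sphere]
    have := hx _ hm₀
    gcongr
    simp only at this
    linarith
  have h2 : δ / 2 ≤ √((1 - inner ℝ (x : E3) ((optimal C x).1 : E3)) / 2) := by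
    apply Real.le_sqrt_of_sq_le
    have := hx _ (optimal_mem ha hC x)
    nlinarith
  calc δ ^ 3 / (2 * a' ^ 2) = δ / 2 * (δ / a') ^ 2 := by field_simp
    _ ≤ _ := by unfold weight; gcongr

lemma weight_continuousAt {p : Paraboloid} (hp : 0 < p.2) (x : S2) :
    ContinuousAt (fun q : Paraboloid => weight q x) p := by
  unfold weight
  exact ContinuousAt.mul (by fun_prop) ((gauge_continuousAt_left hp).pow 2)

lemma aestronglyMeasurable_weight_optimal (ha : 0 < a) (hK : IsClosed K) (hT : IsCompact T)
    (hsep : ∀ x ∈ K, ∀ m ∈ T, inner ℝ (x : E3) (m : E3) < 1)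
    (hC : (C : Set Paraboloid) ⊆ T ×ˢ Icc a β) :
    AEStronglyMeasurable (fun x : S2 => weight (optimal C x) x) (surfaceMeasure.restrict K) := by
  have h := aemeasurable_optimal ha hK hT hsep hC
  have hw : Measurable fun z : Paraboloid × S2 => weight z.1 z.2 := by
    unfold weight gauge
    fun_prop
  exact (hw.comp_aemeasurable (h.prodMk aemeasurable_id)).aestronglyMeasurable

lemma integrable_mul_weight (ha : 0 < a) (hK : IsClosed K) (hT : IsCompact T)
    (hsep : ∀ x ∈ K, ∀ m ∈ T, inner ℝ (x : E3) (m : E3) < 1)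
    (hC : (C : Set Paraboloid) ⊆ T ×ˢ Icc a β) (hf : IntegrableOn f K surfaceMeasure) :
    IntegrableOn (fun x : S2 => f x * weight (optimal C x) x) K surfaceMeasure := by
  refine Integrable.mul_bdd (c := (2 / a) ^ 2) hf
    (aestronglyMeasurable_weight_optimal ha hK hT hsep hC) (.of_forall fun x => ?_)
  rw [Real.norm_of_nonneg (weight_nonneg _ _)]
  have hC' : ∀ p ∈ C, a ≤ p.2 := fun p hp => (hC hp).2.1
  exact weight_le ha (hC' _ (optimal_mem ha hC' x)) x

lemma integrable_flux (ha : 0 < a) (hK : IsClosed K) (hT : IsCompact T)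
    (hsep : ∀ x ∈ K, ∀ m ∈ T, inner ℝ (x : E3) (m : E3) < 1)
    (hC : (C : Set Paraboloid) ⊆ T ×ˢ Icc a β) (hf : IntegrableOn f K surfaceMeasure)
    (hφ : Measurable φ) (hφM : ∀ m, |φ m| ≤ M) :
    IntegrableOn (fun x : S2 => φ (optimal C x).1 * (f x * weight (optimal C x) x)) K
      surfaceMeasure :=
  Integrable.bdd_mul (c := M) (integrable_mul_weight ha hK hT hsep hC hf)
    ((hφ.comp measurable_fst).comp_aemeasurable
      (aemeasurable_optimal ha hK hT hsep hC)).aestronglyMeasurable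
    (.of_forall fun _ => hφM _)

/-- The integral of `φ` against the distribution of the irradiance of the reflector enveloped by
the family `C`. -/
def flux (K : Set S2) (f : S2 → ℝ) (C : NonemptyCompacts Paraboloid) (φ : S2 → ℝ) : ℝ :=
  ∫ x in K, φ (optimal C x).1 * (f x * weight (optimal C x) x) ∂surfaceMeasure

/-- Dominated convergence. Only convergence of `φ` along the optimal axes is required, so the
statement serves both continuous `φ` and indicators of single directions in a finite family. -/
lemma tendsto_flux {ι : Type*} {l : Filter ι} [l.IsCountablyGenerated] (ha : 0 < a)
    (hK : IsClosed K) (hT : IsCompact T)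
    (hsep : ∀ x ∈ K, ∀ m ∈ T, inner ℝ (x : E3) (m : E3) < 1)
    (hC : (C : Set Paraboloid) ⊆ T ×ˢ Icc a β) (hf : IntegrableOn f K surfaceMeasure)
    {Ck : ι → NonemptyCompacts Paraboloid}
    (hCk : ∀ᶠ k in l, (Ck k : Set Paraboloid) ⊆ T ×ˢ Icc a β) (hlim : Tendsto Ck l (𝓝 C))
    (hφ : Measurable φ) (hφM : ∀ m, |φ m| ≤ M)
    (hφlim : ∀ x : S2, Tendsto (fun k => optimal (Ck k) x) l (𝓝 (optimal C x)) →
      Tendsto (fun k => φ (optimal (Ck k) x).1) l (𝓝 (φ (optimal C x).1))) :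
    Tendsto (fun k => flux K f (Ck k) φ) l (𝓝 (flux K f C φ)) := by
  have hC' : ∀ p ∈ C, a ≤ p.2 := fun p hp => (hC hp).2.1
  refine tendsto_integral_filter_of_dominated_convergence
    (fun x => M * (|f x| * (2 / a) ^ 2)) ?_ ?_ ?_ ?_
  · filter_upwards [hCk] with k hk
    exact (integrable_flux ha hK hT hsep hk hf hφ hφM).aestronglyMeasurable
  · filter_upwards [hCk] with k hk
    refine .of_forall fun x => ?_
    have hk' : ∀ p ∈ Ck k, a ≤ p.2 := fun p hp => (hk hp).2.1
    rw [norm_mul, norm_mul, Real.norm_of_nonneg (weight_nonneg _ _)]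
    have hM : 0 ≤ M := (abs_nonneg _).trans (hφM x)
    have := weight_le ha (hk' _ (optimal_mem ha hk' x)) x
    have h1 := hφM (optimal (Ck k) x).1
    rw [← Real.norm_eq_abs] at h1 ⊢
    gcongr
    exact mul_nonneg (norm_nonneg _) (weight_nonneg _ _)
  · exact (hf.abs.mul_const _).const_mul _
  · filter_upwards [ae_mem_and_differentiableAt ha hC' hK] with x hx
    have h := tendsto_optimal_of_differentiableAt ha hT hsep hC hCk hlim hx.1 hx.2
      (tendsto_const_nhds (x := x))
    refine (hφlim x h).mul (Tendsto.const_mul _ ?_)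
    exact (weight_continuousAt (ha.trans_le (hC' _ (optimal_mem ha hC' x))) x).tendsto.comp h

end Flux

/-! ### The discrete problem -/

/-- The family of paraboloids with axis directions in the finite set `s` and focal parameters `d`. -/
def graphFamily {s : Finset S2} [Nonempty s] (d : s → ℝ) : NonemptyCompacts Paraboloid :=
  NonemptyCompacts.map (fun m : s => ((m : S2), d m)) (by fun_prop) ⊤

section Discrete

variable {s : Finset S2} [Nonempty s] {d : s → ℝ} {a β : ℝ} {K T : Set S2} {f φ : S2 → ℝ}

lemma mem_graphFamily {p : Paraboloid} : p ∈ graphFamily d ↔ ∃ m : s, ((m : S2), d m) = p := by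
  change p ∈ (graphFamily d : Set Paraboloid) ↔ _
  simp [graphFamily]

lemma continuous_graphFamily : Continuous (graphFamily (s := s)) := by
  unfold graphFamily
  refine Continuous.nonemptyCompacts_map' (g := fun (d : s → ℝ) (m : s) => ((m : S2), d m))
    continuous_const ?_
  refine continuous_prod_of_discrete_right.2 fun m => ?_
  simp only [Function.uncurry]
  fun_prop

lemma graphFamily_subset (hs : (s : Set S2) ⊆ T) (hd : ∀ i, d i ∈ Icc a β) :
    (graphFamily d : Set Paraboloid) ⊆ T ×ˢ Icc a β := by
  intro p hp
  obtain ⟨m, rfl⟩ := mem_graphFamily.1 hp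
  exact ⟨hs m.2, hd m⟩

lemma le_of_mem_graphFamily (hd : ∀ i, a ≤ d i) : ∀ p ∈ graphFamily d, a ≤ p.2 := by
  intro p hp
  obtain ⟨m, rfl⟩ := mem_graphFamily.1 hp
  exact hd m

lemma fst_mem_of_mem_graphFamily : ∀ p ∈ graphFamily d, p.1 ∈ s := by
  intro p hp
  obtain ⟨m, rfl⟩ := mem_graphFamily.1 hp
  exact m.2

lemma eq_of_mem_graphFamily {p : Paraboloid} (hp : p ∈ graphFamily d) (i : s)
    (h : p.1 = i) : p = ((i : S2), d i) := by
  obtain ⟨m, rfl⟩ := mem_graphFamily.1 hp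
  obtain rfl : m = i := Subtype.ext h
  rfl

/-- The energy sent into the single direction `i`. -/
abbrev fluxAt (K : Set S2) (f : S2 → ℝ) (C : NonemptyCompacts Paraboloid) (i : S2) : ℝ :=
  flux K f C (indicator {i} fun _ => 1)

lemma measurable_indicator_singleton (i : S2) :
    Measurable (indicator {i} fun _ : S2 => (1 : ℝ)) :=
  measurable_const.indicator (measurableSet_singleton i)

lemma abs_indicator_singleton_le (i m : S2) : |indicator {i} (fun _ : S2 => (1 : ℝ)) m| ≤ 1 := by
  by_cases h : m = i <;> simp [h]

lemma continuousOn_fluxAt (ha : 0 < a) (hK : IsClosed K) (hT : IsCompact T)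
    (hsep : ∀ x ∈ K, ∀ m ∈ T, inner ℝ (x : E3) (m : E3) < 1) (hs : (s : Set S2) ⊆ T)
    (hf : IntegrableOn f K surfaceMeasure) (i : S2) :
    ContinuousOn (fun d : s → ℝ => fluxAt K f (graphFamily d) i) (Icc (fun _ => a) fun _ => β) := by
  intro d hd
  have hbox : ∀ᶠ d' in 𝓝[Icc (fun _ => a) fun _ => β] d, ∀ j : s, d' j ∈ Icc a β := by
    filter_upwards [self_mem_nhdsWithin] with d' hd' j using ⟨hd'.1 j, hd'.2 j⟩
  have hlim : Tendsto (graphFamily (s := s)) (𝓝[Icc (fun _ => a) fun _ => β] d)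
      (𝓝 (graphFamily d)) := (continuous_graphFamily.tendsto d).mono_left nhdsWithin_le_nhds
  refine tendsto_flux ha hK hT hsep (graphFamily_subset hs fun j => ⟨hd.1 j, hd.2 j⟩) hf
    (hbox.mono fun d' h => graphFamily_subset hs h) hlim (measurable_indicator_singleton i)
    (abs_indicator_singleton_le i) fun x hx => ?_
  have h1 : Tendsto (fun d' => (optimal (graphFamily d') (x : E3)).1)
      (𝓝[Icc (fun _ => a) fun _ => β] d) (𝓝 (optimal (graphFamily d) (x : E3)).1) :=
    (continuous_fst.tendsto _).comp hx
  -- The axes belong to the finite set `s`, so a convergent optimal axis is eventually constant and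
  -- the jump of the indicator does no harm.
  have hfin : ((s.erase (optimal (graphFamily d) (x : E3)).1 : Finset S2) : Set S2)ᶜ ∈
      𝓝 (optimal (graphFamily d) (x : E3)).1 :=
    (Finset.finite_toSet _).isClosed.isOpen_compl.mem_nhds (by simp)
  refine tendsto_const_nhds.congr' ?_
  filter_upwards [h1.eventually hfin, hbox] with d' h2 h3
  have h4 := fst_mem_of_mem_graphFamily _
    (optimal_mem ha (le_of_mem_graphFamily fun j => (h3 j).1) (x : E3))
  have h5 : (optimal (graphFamily d') (x : E3)).1 = (optimal (graphFamily d) (x : E3)).1 := by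
    by_contra hne
    exact h2 (by simp [hne, h4])
  rw [h5]

/-- Decreasing one focal parameter decreases the energy sent into all the other directions. -/
lemma fluxAt_le_of_le (ha : 0 < a) (hK : IsClosed K) (hT : IsCompact T)
    (hsep : ∀ x ∈ K, ∀ m ∈ T, inner ℝ (x : E3) (m : E3) < 1) (hs : (s : Set S2) ⊆ T)
    (hf : IntegrableOn f K surfaceMeasure)
    (hf0 : ∀ᵐ x ∂surfaceMeasure.restrict K, 0 ≤ f x) {d' : s → ℝ}
    (hd : ∀ j, d j ∈ Icc a β) (hd' : ∀ j, d' j ∈ Icc a β) (hle : ∀ j, d' j ≤ d j) {i : s}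
    (hi : d' i = d i) : fluxAt K f (graphFamily d') i ≤ fluxAt K f (graphFamily d) i := by
  have hC := le_of_mem_graphFamily fun j => (hd j).1
  have hC' := le_of_mem_graphFamily fun j => (hd' j).1
  refine integral_mono_ae
    (integrable_flux ha hK hT hsep (graphFamily_subset hs hd') hf
      (measurable_indicator_singleton i) (abs_indicator_singleton_le i))
    (integrable_flux ha hK hT hsep (graphFamily_subset hs hd) hf
      (measurable_indicator_singleton i) (abs_indicator_singleton_le i)) ?_
  filter_upwards [ae_mem_and_differentiableAt ha hC hK, hf0] with x hx hfx
  by_cases h : (optimal (graphFamily d') (x : E3)).1 = i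
  · have h1 := eq_of_mem_graphFamily (optimal_mem ha hC' (x : E3)) i h
    rw [hi] at h1
    -- Passing from `d'` to the larger `d` lowers the competing gauges and leaves that of `i`
    -- unchanged: directions sent to `i` stay with `i`.
    have h2 : ((i : S2), d i) = optimal (graphFamily d) (x : E3) := by
      refine optimal_unique ha hC hx.2 (fun p hp => hsep x hx.1 _
        (hs (fst_mem_of_mem_graphFamily p hp))) (mem_graphFamily.2 ⟨i, rfl⟩) fun p hp => ?_
      obtain ⟨j, rfl⟩ := mem_graphFamily.1 hp
      rw [← h1]
      refine le_trans ?_ ((optimal_spec ha hC' (x : E3)).2 ((j : S2), d' j)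
        (mem_graphFamily.2 ⟨j, rfl⟩))
      rw [gauge_sphere, gauge_sphere]
      exact div_le_div_of_nonneg_left (one_sub_inner_nonneg _ _) (ha.trans_le (hd' j).1) (hle j)
    rw [h1, h2]
  · rw [indicator_of_notMem (by simpa using h), zero_mul]
    exact mul_nonneg (indicator_nonneg (by simp) _) (mul_nonneg hfx (weight_nonneg _ _))

lemma flux_eq_sum {t : Finset S2} (ha : 0 < a) (hK : IsClosed K) (hT : IsCompact T)
    (hsep : ∀ x ∈ K, ∀ m ∈ T, inner ℝ (x : E3) (m : E3) < 1)
    (hf : IntegrableOn f K surfaceMeasure) {C : NonemptyCompacts Paraboloid}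
    (hC : (C : Set Paraboloid) ⊆ T ×ˢ Icc a β) (hCs : ∀ p ∈ C, p.1 ∈ t) (φ : S2 → ℝ) :
    flux K f C φ = ∑ m ∈ t, φ m * fluxAt K f C m := by
  simp only [fluxAt, flux]
  simp only [← integral_const_mul]
  rw [← integral_finsetSum]
  · refine integral_congr_ae (.of_forall fun x => ?_)
    have hmem := hCs _ (optimal_mem ha (fun p hp => (hC hp).2.1) (x : E3))
    simp only
    rw [Finset.sum_eq_single_of_mem _ hmem]
    · simp
    · intro m _ hm
      rw [indicator_of_notMem (by simpa using hm.symm)]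
      simp
  · intro m _
    exact (integrable_flux ha hK hT hsep hC hf
      (measurable_indicator_singleton m) (abs_indicator_singleton_le m)).const_mul _

lemma le_flux_one {δ a' : ℝ} (hδ : 0 < δ) (hδ1 : δ < 1) (ha' : 0 < a') (ha : 0 < a)
    (hK : IsClosed K) (hT : IsCompact T)
    (hsep : ∀ x ∈ K, ∀ m ∈ T, inner ℝ (x : E3) (m : E3) ≤ 1 - δ)
    (hf : IntegrableOn f K surfaceMeasure)
    (hf0 : ∀ᵐ x ∂surfaceMeasure.restrict K, 0 ≤ f x) {C : NonemptyCompacts Paraboloid}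
    (hC : (C : Set Paraboloid) ⊆ T ×ˢ Icc a β) {m₀ : S2} (hm₀ : (m₀, a') ∈ C) :
    δ ^ 3 / (2 * a' ^ 2) * ∫ x in K, f x ∂surfaceMeasure ≤ flux K f C fun _ => 1 := by
  have hsep' : ∀ x ∈ K, ∀ m ∈ T, inner ℝ (x : E3) (m : E3) < 1 := fun x hx m hm => by
    linarith [hsep x hx m hm]
  rw [← integral_const_mul, flux]
  refine integral_mono_ae (hf.const_mul _) (integrable_flux ha hK hT hsep' hC hf
    measurable_const (M := 1) (by simp)) ?_
  filter_upwards [hf0, ae_restrict_mem hK.measurableSet] with x hfx hx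
  rw [one_mul, mul_comm]
  exact mul_le_mul_of_nonneg_left (le_weight_optimal hδ hδ1 ha' ha (fun p hp => (hC hp).2.1)
    (fun p hp => hsep x hx _ (hC hp).1) hm₀) hfx

lemma exists_optimal_fst_eq_of_fluxAt_ne_zero {C : NonemptyCompacts Paraboloid} {i : S2}
    (hK : IsClosed K) (h : fluxAt K f C i ≠ 0) : ∃ x ∈ K, (optimal C (x : E3)).1 = i := by
  by_contra! hne
  refine h ?_
  rw [fluxAt, flux]
  refine (setIntegral_congr_fun (g := fun _ => 0) hK.measurableSet fun x hx => ?_).trans (by simp)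
  simp only
  rw [indicator_of_notMem (by simpa using hne x hx), zero_mul]

/-- Solution of the reflector problem for a discrete target: the prescribed energy reaches every
direction but `m₀`. -/
theorem exists_discrete_reflector {δ a' : ℝ} (hδ : 0 < δ) (hδ1 : δ < 1) (ha : 0 < a)
    (ha' : 4 * a / δ ≤ a') (hK : IsClosed K) (hT : IsCompact T)
    (hsep : ∀ x ∈ K, ∀ m ∈ T, inner ℝ (x : E3) (m : E3) ≤ 1 - δ)
    (hs : (s : Set S2) ⊆ T) (hf : IntegrableOn f K surfaceMeasure)
    (hf0 : ∀ᵐ x ∂surfaceMeasure.restrict K, 0 ≤ f x) {m₀ : S2} (hm₀ : m₀ ∈ s) {g : S2 → ℝ}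
    (hg : ∀ m, 0 ≤ g m) (hgm₀ : 0 < g m₀)
    (henergy : ∑ m ∈ s, g m ≤ δ ^ 3 / (2 * a' ^ 2) * ∫ x in K, f x ∂surfaceMeasure) :
    ∃ C : NonemptyCompacts Paraboloid, (C : Set Paraboloid) ⊆ T ×ˢ Icc (2 * a) (3 * a' / δ) ∧
      (m₀, a') ∈ C ∧ (∀ p ∈ C, p.1 ∈ s) ∧ ∀ m ∈ s, m ≠ m₀ → fluxAt K f C m = g m := by
  have hsep' : ∀ x ∈ K, ∀ m ∈ T, inner ℝ (x : E3) (m : E3) < 1 := fun x hx m hm => by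
    linarith [hsep x hx m hm]
  have haa' : 4 * a ≤ δ * a' := by
    rw [div_le_iff₀ hδ] at ha'
    linarith
  have ha'0 : 0 < a' := lt_of_lt_of_le (by positivity) ha'
  have hale : a ≤ a' := by nlinarith
  -- Beyond `2 a' / δ` a paraboloid is everywhere dominated over `K` by `(m₀, a')` and receives
  -- nothing.
  obtain ⟨β, hβ⟩ : ∃ β, β = 3 * a' / δ := ⟨_, rfl⟩
  have hβδ : β * δ = 3 * a' := by rw [hβ]; field_simp
  have ha'β : a' ≤ β := by
    rw [hβ, le_div_iff₀ hδ]
    nlinarith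
  rw [← hβ]
  let i₀ : s := ⟨m₀, hm₀⟩
  let box : Set (s → ℝ) := Icc (fun _ => a) fun _ => β
  have hboxmem : ∀ d, d ∈ box ↔ ∀ j, d j ∈ Icc a β := fun d =>
    ⟨fun h j => ⟨h.1 j, h.2 j⟩, fun h => ⟨fun j => (h j).1, fun j => (h j).2⟩⟩
  have hcont : ∀ i : s, ContinuousOn (fun d : s → ℝ => fluxAt K f (graphFamily d) i) box :=
    fun i => continuousOn_fluxAt ha hK hT hsep' hs hf i
  -- Admissible parameters. The lower bound `a` of the box is half the bound to be proved, which
  -- leaves room to decrease any parameter of a minimiser.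
  let W : Set (s → ℝ) := (box ∩ {d | d i₀ = a'}) ∩
    ⋂ i : s, ⋂ _ : i ≠ i₀, box ∩ (fun d => fluxAt K f (graphFamily d) i) ⁻¹' Iic (g i)
  have hWmem : ∀ d, d ∈ W ↔ d ∈ box ∧ d i₀ = a' ∧
      ∀ i : s, i ≠ i₀ → fluxAt K f (graphFamily d) i ≤ g i := by
    intro d
    simp only [W, mem_inter_iff, mem_iInter, mem_ofPred_eq, mem_preimage, mem_Iic]
    constructor
    · exact fun h => ⟨h.1.1, h.1.2, fun i hi => (h.2 i hi).2⟩
    · exact fun h => ⟨⟨h.1, h.2.1⟩, fun i hi => ⟨h.1, h.2.2 i hi⟩⟩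
  have hWcompact : IsCompact W := by
    refine isCompact_Icc.of_isClosed_subset (s := box) ?_ fun d hd => hd.1.1
    refine (isClosed_Icc.inter (isClosed_eq (by fun_prop) continuous_const)).inter ?_
    exact isClosed_iInter fun i => isClosed_iInter fun _ =>
      (hcont i).preimage_isClosed_of_isClosed isClosed_Icc isClosed_Iic
  have hm₀mem : ∀ d : s → ℝ, d i₀ = a' → (m₀, a') ∈ graphFamily d := fun d hd =>
    mem_graphFamily.2 ⟨i₀, by rw [hd]⟩
  have hWne : W.Nonempty := by
    classical
    refine ⟨fun i => if i = i₀ then a' else β, (hWmem _).2 ⟨?_, by simp, fun i hi => ?_⟩⟩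
    · rw [hboxmem]
      intro j
      by_cases hj : j = i₀
      · simp [hj, hale, ha'β]
      · simp [hj, hale.trans ha'β]
    · refine le_of_eq_of_le ?_ (hg i)
      by_contra hne
      obtain ⟨x, hx, hxi⟩ := exists_optimal_fst_eq_of_fluxAt_ne_zero hK hne
      have hC : ∀ p ∈ graphFamily fun i : s => if i = i₀ then a' else β, a ≤ p.2 :=
        le_of_mem_graphFamily fun j => by split_ifs <;> linarith
      have h1 := eq_of_mem_graphFamily (optimal_mem ha hC (x : E3)) i hxi
      have h2 := (optimal_spec ha hC (x : E3)).2 _ (hm₀mem _ (by simp))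
      rw [h1, gauge_sphere, gauge_sphere] at h2
      simp only [hi, if_false] at h2
      have h3 := one_sub_inner_le_two x i
      have h4 := hsep x hx m₀ (hs hm₀)
      have hβ0 : 0 < β := by linarith
      rw [div_le_div_iff₀ ha'0 hβ0] at h2
      nlinarith
  obtain ⟨d, hdW, hdmin⟩ := hWcompact.exists_isMinOn hWne
    (f := fun d : s → ℝ => ∑ i, d i) (by fun_prop)
  obtain ⟨hdbox, hd₀, hdle⟩ := (hWmem d).1 hdW
  rw [hboxmem] at hdbox
  have hCsub := graphFamily_subset hs hdbox
  have hC : ∀ p ∈ graphFamily d, a ≤ p.2 := le_of_mem_graphFamily fun j => (hdbox j).1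
  have hlarge : ∀ i, 2 * a ≤ d i := by
    have htot := (henergy.trans (le_flux_one hδ hδ1 ha'0 ha hK hT hsep hf hf0 hCsub
      (hm₀mem d hd₀))).trans_eq
      (flux_eq_sum ha hK hT hsep' hf hCsub fst_mem_of_mem_graphFamily _)
    simp only [one_mul] at htot
    rw [← Finset.add_sum_erase _ _ hm₀, ← Finset.add_sum_erase _ _ hm₀] at htot
    -- The total energy suffices and the other directions are not overfed, so `m₀` receives at least
    -- `g m₀ > 0`. At a point `x` sent to `m₀`, optimality gives `δ / d i ≤ 2 / a'`, whence `d i ≥ δ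
    -- a' / 2 ≥ 2 a`.
    have hrest : ∑ m ∈ s.erase m₀, fluxAt K f (graphFamily d) m ≤ ∑ m ∈ s.erase m₀, g m :=
      Finset.sum_le_sum fun m hm => hdle ⟨m, Finset.mem_of_mem_erase hm⟩ fun h =>
        Finset.ne_of_mem_erase hm (congrArg Subtype.val h)
    obtain ⟨x, hx, hxm⟩ := exists_optimal_fst_eq_of_fluxAt_ne_zero (C := graphFamily d) (f := f)
      (i := m₀) hK (by intro h; linarith)
    intro i
    have h1 := eq_of_mem_graphFamily (optimal_mem ha hC (x : E3)) i₀ hxm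
    have h2 := (optimal_spec ha hC (x : E3)).2 _ (mem_graphFamily.2 ⟨i, rfl⟩)
    rw [h1, hd₀, gauge_sphere, gauge_sphere, div_le_div_iff₀ (ha.trans_le (hdbox i).1) ha'0] at h2
    simp only at h2
    have h3 := one_sub_inner_le_two x i₀
    have h4 := hsep x hx i (hs i.2)
    have h5 := (hdbox i).1
    nlinarith
  refine ⟨graphFamily d, graphFamily_subset hs fun j => ⟨hlarge j, (hdbox j).2⟩, hm₀mem d hd₀,
    fst_mem_of_mem_graphFamily, fun m hm hne => ?_⟩
  obtain ⟨i, rfl⟩ : ∃ i : s, (i : S2) = m := ⟨⟨m, hm⟩, rfl⟩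
  have hi : i ≠ i₀ := fun h => hne (by rw [h])
  refine (hdle i hi).eq_of_not_lt fun hlt => ?_
  classical
  have hupd : ∀ t ∈ Icc a (d i), ∀ j, Function.update d i t j ∈ Icc a β := by
    intro t ht j
    by_cases hj : j = i
    · subst hj
      simpa using ⟨ht.1, ht.2.trans (hdbox j).2⟩
    · simpa [hj] using hdbox j
  -- If `i` received too little, `d i` could be decreased slightly: continuity preserves the strict
  -- constraint at `i`, monotonicity the others, and the sum would drop below its minimum.
  have hIoo : Ioo a (d i) ∈ 𝓝[<] (d i) := Ioo_mem_nhdsLT (by linarith [hlarge i])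
  have htend : Tendsto (fun t => Function.update d i t) (𝓝[<] (d i)) (𝓝[box] d) := by
    refine tendsto_nhdsWithin_iff.2 ⟨?_, ?_⟩
    · have : Continuous fun t => Function.update d i t := by fun_prop
      have h := this.tendsto (d i)
      rw [Function.update_eq_self] at h
      exact h.mono_left nhdsWithin_le_nhds
    · filter_upwards [hIoo] with t ht
      exact (hboxmem _).2 (hupd t (Ioo_subset_Icc_self ht))
  have hev := ((hcont i d ((hboxmem d).2 hdbox)).tendsto.comp htend).eventually_lt_const hlt
  obtain ⟨t, ht, htI⟩ := (hev.and hIoo).exists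
  have hle : ∀ j, Function.update d i t j ≤ d j := by
    intro j
    by_cases hj : j = i
    · subst hj
      simpa using htI.2.le
    · simp [hj]
  have hW' : Function.update d i t ∈ W := by
    refine (hWmem _).2 ⟨(hboxmem _).2 (hupd t (Ioo_subset_Icc_self htI)), ?_, fun j hj => ?_⟩
    · rw [Function.update_of_ne hi.symm, hd₀]
    · by_cases hji : j = i
      · rw [hji]
        exact ht.le
      · exact (fluxAt_le_of_le ha hK hT hsep' hs hf hf0 hdbox
          (hupd t (Ioo_subset_Icc_self htI)) hle (Function.update_of_ne hji _ _)).trans (hdle j hj)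
  have hmin := hdmin hW'
  simp only [mem_ofPred_eq] at hmin
  refine absurd hmin (not_le.2 (Finset.sum_lt_sum (fun j _ => hle j) ⟨i, Finset.mem_univ i, ?_⟩))
  simpa using htI.2

end Discrete

/-! ### Approximation of a general target measure -/

variable {a δ a' β : ℝ} {K T : Set S2} {f : S2 → ℝ} {m₀ : S2}

/-- Finitely valued maps into `T` that converge to the identity on `T` and are equal to `m₀`
near `m₀`. -/
lemma exists_simpleFunc_tendsto (hm₀ : m₀ ∈ T) :
    ∃ q : ℕ → SimpleFunc S2 S2, (∀ n y, q n y ∈ T) ∧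
      (∀ y ∈ T, Tendsto (fun n => q n y) atTop (𝓝 y)) ∧ ∀ n, q n ⁻¹' {m₀} ∈ 𝓝 m₀ := by
  have : Nonempty T := ⟨⟨m₀, hm₀⟩⟩
  -- Starting a dense sequence with `m₀` makes `m₀` a candidate for every nearest-point map, so
  -- values at points near `m₀` are near `m₀`; finiteness of the range then makes them equal to it.
  obtain ⟨e, he0, heS⟩ : ∃ e : ℕ → S2, e 0 = m₀ ∧ ∀ k, e (k + 1) = denseSeq T k :=
    ⟨fun n => Nat.casesOn n m₀ fun k => (denseSeq T k : S2), rfl, fun _ => rfl⟩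
  have heT : ∀ n, e n ∈ T := by
    intro n
    cases n with
    | zero => exact he0 ▸ hm₀
    | succ k => exact heS k ▸ (denseSeq T k).2
  have hdense : ∀ y ∈ T, y ∈ closure (range e) := by
    intro y hy
    have h1 : (⟨y, hy⟩ : T) ∈ closure (range (denseSeq T)) := denseRange_denseSeq T _
    have h2 : y ∈ closure (Subtype.val '' range (denseSeq T)) :=
      image_closure_subset_closure_image continuous_subtype_val ⟨_, h1, rfl⟩
    have h3 : Subtype.val '' range (denseSeq T) ⊆ range e := by
      rintro _ ⟨_, ⟨k, rfl⟩, rfl⟩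
      exact ⟨k + 1, heS k⟩
    exact closure_mono h3 h2
  refine ⟨fun n => SimpleFunc.nearestPt e n, fun n y => ?_,
    fun y hy => SimpleFunc.tendsto_nearestPt (hdense y hy), fun n => ?_⟩
  · exact heT (SimpleFunc.nearestPtInd e n y)
  · have hle : ∀ y, edist (SimpleFunc.nearestPt e n y) y ≤ edist m₀ y := fun y =>
      he0 ▸ SimpleFunc.edist_nearestPt_le e y (Nat.zero_le n)
    have hbound : Tendsto (fun y : S2 => edist m₀ y + edist m₀ y) (𝓝 m₀) (𝓝 0) := by
      have : Continuous fun y : S2 => edist m₀ y + edist m₀ y := by fun_prop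
      simpa using this.tendsto m₀
    have htend : Tendsto (fun y => SimpleFunc.nearestPt e n y) (𝓝 m₀) (𝓝 m₀) := by
      rw [tendsto_iff_edist_tendsto_0]
      refine tendsto_of_tendsto_of_tendsto_of_le_of_le tendsto_const_nhds hbound
        (fun _ => zero_le) fun y => ?_
      refine (edist_triangle _ y _).trans ?_
      rw [edist_comm y m₀]
      gcongr
      exact hle y
    have hfin : (((SimpleFunc.nearestPt e n).range.erase m₀ : Finset S2) : Set S2)ᶜ ∈ 𝓝 m₀ :=
      (Finset.finite_toSet _).isClosed.isOpen_compl.mem_nhds (by simp)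
    filter_upwards [htend.eventually hfin] with y hy
    by_contra hne
    exact hy (by simpa using hne)

lemma integral_comp_simpleFunc (η : Measure S2) [IsFiniteMeasure η] (q : SimpleFunc S2 S2)
    (φ : S2 → ℝ) : ∫ y, φ (q y) ∂η = ∑ m ∈ q.range, φ m * η.real (q ⁻¹' {m}) := by
  have h : ∀ y, φ (q y) = ∑ m ∈ q.range, (q ⁻¹' {m}).indicator (fun _ => φ m) y := by
    intro y
    rw [Finset.sum_eq_single_of_mem (q y) (q.mem_range_self y)]
    · simp
    · intro m _ hm
      exact indicator_of_notMem (by simpa using hm.symm) _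
  simp only [h]
  rw [integral_finsetSum _ fun m _ => (integrable_const _).indicator (q.measurableSet_preimage _)]
  refine Finset.sum_congr rfl fun m _ => ?_
  rw [integral_indicator_const _ (q.measurableSet_preimage _), smul_eq_mul, mul_comm]

/-- Solution of the reflector problem in weak form: the irradiance of the reflector enveloped by
`C` is distributed according to `η`, up to a surplus in the direction `m₀`. -/
theorem exists_weak_reflector (hδ : 0 < δ) (hδ1 : δ < 1) (ha : 0 < a)
    (ha' : 4 * a / δ ≤ a') (hK : IsClosed K) (hT : IsCompact T)
    (hsep : ∀ x ∈ K, ∀ m ∈ T, inner ℝ (x : E3) (m : E3) ≤ 1 - δ)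
    (hf : IntegrableOn f K surfaceMeasure)
    (hf0 : ∀ᵐ x ∂surfaceMeasure.restrict K, 0 ≤ f x) (η : Measure S2) [IsFiniteMeasure η]
    (hη : η Tᶜ = 0) (hm₀T : m₀ ∈ T) (hm₀ : m₀ ∈ η.support)
    (henergy : η.real univ ≤ δ ^ 3 / (2 * a' ^ 2) * ∫ x in K, f x ∂surfaceMeasure) :
    ∃ C : NonemptyCompacts Paraboloid, (C : Set Paraboloid) ⊆ T ×ˢ Icc (2 * a) (3 * a' / δ) ∧
      (m₀, a') ∈ C ∧ ∃ r : ℝ, 0 ≤ r ∧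
        ∀ φ : S2 →ᵇ ℝ, flux K f C φ = ∫ y, φ y ∂η + r * φ m₀ := by
  have hsep' : ∀ x ∈ K, ∀ m ∈ T, inner ℝ (x : E3) (m : E3) < 1 := fun x hx m hm => by
    linarith [hsep x hx m hm]
  have ha2 : 0 < 2 * a := by positivity
  have ha'0 : 0 < a' := lt_of_lt_of_le (by positivity) ha'
  obtain ⟨q, hqT, hqlim, hqm₀⟩ := exists_simpleFunc_tendsto hm₀T
  -- The surplus at `m₀` is written as total flux minus total mass: unlike `fluxAt` at `m₀`, this
  -- involves only a continuous test function and survives the limit.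
  have hdisc : ∀ n, ∃ C : NonemptyCompacts Paraboloid,
      (C : Set Paraboloid) ⊆ T ×ˢ Icc (2 * a) (3 * a' / δ) ∧ (m₀, a') ∈ C ∧
      ∀ φ : S2 → ℝ, flux K f C φ =
        ∫ y, φ (q n y) ∂η + (flux K f C (fun _ => 1) - η.real univ) * φ m₀ := by
    intro n
    have hqm : q n m₀ = m₀ := mem_of_mem_nhds (s := q n ⁻¹' {m₀}) (hqm₀ n)
    have hm₀s : m₀ ∈ (q n).range := SimpleFunc.mem_range.2 ⟨m₀, hqm⟩
    have : Nonempty (q n).range := ⟨⟨m₀, hm₀s⟩⟩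
    have hsum : ∑ m ∈ (q n).range, η.real (q n ⁻¹' {m}) = η.real univ := by
      have := integral_comp_simpleFunc η (q n) fun _ => 1
      simpa using this.symm
    obtain ⟨C, hC, hCm₀, hCs, hCg⟩ := exists_discrete_reflector (s := (q n).range)
      (g := fun m => η.real (q n ⁻¹' {m})) hδ hδ1 ha ha' hK hT hsep
      (by
        intro m hm
        obtain ⟨y, rfl⟩ := SimpleFunc.mem_range.1 hm
        exact hqT n y) hf hf0 hm₀s (fun _ => measureReal_nonneg)
      -- The cell of `m₀` is a neighbourhood of a point of the support, so it has positive mass.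
      (ENNReal.toReal_pos (((Measure.mem_support_iff_forall m₀).1 hm₀ _ (hqm₀ n)).ne')
        (measure_ne_top _ _)) (hsum.trans_le henergy)
    refine ⟨C, hC, hCm₀, fun φ => ?_⟩
    have hφ : ∀ φ : S2 → ℝ, flux K f C φ = ∫ y, φ (q n y) ∂η +
        (fluxAt K f C m₀ - η.real (q n ⁻¹' {m₀})) * φ m₀ := by
      intro φ
      rw [flux_eq_sum ha2 hK hT hsep' hf hC hCs, integral_comp_simpleFunc,
        ← Finset.add_sum_erase _ _ hm₀s, ← Finset.add_sum_erase _ _ hm₀s,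
        Finset.sum_congr rfl fun m hm => by
          rw [hCg m (Finset.mem_of_mem_erase hm) (Finset.ne_of_mem_erase hm)]]
      ring
    have h1 := hφ fun _ => 1
    simp only [integral_const, smul_eq_mul, mul_one] at h1
    rw [hφ φ, h1]
    ring
  choose Cn hCn hCnm₀ hCnφ using hdisc
  -- The nonempty compact subsets of a compact set form a compact space, which yields a limit family
  -- without any bound on the number of directions.
  obtain ⟨C, hC, ψ, hψ, hlim⟩ := (NonemptyCompacts.isCompact_subsets_of_isCompact
    (hT.prod (isCompact_Icc (a := 2 * a) (b := 3 * a' / δ)))).tendsto_subseq hCn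
  have hCm₀ : (m₀, a') ∈ C := by
    have hclosed : IsClosed {L : NonemptyCompacts Paraboloid |
        ((L : Set Paraboloid) ∩ {(m₀, a')}).Nonempty} :=
      NonemptyCompacts.isClosed_inter_nonempty_of_isClosed isClosed_singleton
    obtain ⟨p, hp, rfl⟩ := hclosed.mem_of_tendsto hlim
      (.of_forall fun n => ⟨_, hCnm₀ (ψ n), rfl⟩)
    exact hp
  refine ⟨C, hC, hCm₀, flux K f C (fun _ => 1) - η.real univ, ?_, fun φ => ?_⟩
  · exact sub_nonneg.2
      (henergy.trans (le_flux_one hδ hδ1 ha'0 ha2 hK hT hsep hf hf0 hC hCm₀))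
  · have hflux : ∀ φ : S2 →ᵇ ℝ,
        Tendsto (fun n => flux K f (Cn (ψ n)) φ) atTop (𝓝 (flux K f C φ)) := fun φ =>
      tendsto_flux ha2 hK hT hsep' hC hf (.of_forall fun n => hCn (ψ n)) hlim
        φ.continuous.measurable (fun m => φ.norm_coe_le_norm m) fun x hx =>
          (φ.continuous.tendsto _).comp ((continuous_fst.tendsto _).comp hx)
    have hint : Tendsto (fun n => ∫ y, φ (q (ψ n) y) ∂η) atTop (𝓝 (∫ y, φ y ∂η)) := by
      refine tendsto_integral_of_dominated_convergence (fun _ => ‖φ‖) (fun n => ?_)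
        (integrable_const _) (fun n => .of_forall fun y => φ.norm_coe_le_norm _) ?_
      · exact (φ.continuous.measurable.comp (q (ψ n)).measurable).aestronglyMeasurable
      · have : ∀ᵐ y ∂η, y ∈ T := by
          rw [ae_iff]
          exact hη
        filter_upwards [this] with y hy
        exact (φ.continuous.tendsto y).comp ((hqlim y hy).comp hψ.tendsto_atTop)
    have hone := hflux (BoundedContinuousFunction.const S2 1)
    refine tendsto_nhds_unique (hflux φ) ?_
    refine (hint.add ((hone.sub_const (η.real univ)).mul_const (φ m₀))).congr fun n => ?_
    exact (hCnφ (ψ n) φ).symm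

/-- The weak form of the reflector equation determines the energy reaching any Borel set. -/
lemma flux_indicator_eq (ha : 0 < a) (hK : IsClosed K) (hT : IsCompact T)
    (hsep : ∀ x ∈ K, ∀ m ∈ T, inner ℝ (x : E3) (m : E3) < 1)
    (hf : IntegrableOn f K surfaceMeasure)
    (hf0 : ∀ᵐ x ∂surfaceMeasure.restrict K, 0 ≤ f x) {C : NonemptyCompacts Paraboloid}
    (hC : (C : Set Paraboloid) ⊆ T ×ˢ Icc a β) (η : Measure S2) [IsFiniteMeasure η] {r : ℝ}
    (hr : 0 ≤ r) (h : ∀ φ : S2 →ᵇ ℝ, flux K f C φ = ∫ y, φ y ∂η + r * φ m₀) {E : Set S2}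
    (hE : MeasurableSet E) :
    flux K f C (E.indicator fun _ => 1) = η.real E + r * E.indicator (fun _ => 1) m₀ := by
  let F : S2 → ℝ := fun x => f x * weight (optimal C (x : E3)) x
  have hF : Integrable F (surfaceMeasure.restrict K) := integrable_mul_weight ha hK hT hsep hC hf
  have hF0 : ∀ᵐ x ∂surfaceMeasure.restrict K, 0 ≤ F x := by
    filter_upwards [hf0] with x hx using mul_nonneg hx (weight_nonneg _ _)
  -- The pushforward of `μ` under the optimal axis represents the flux as a measure; testing with
  -- bounded continuous functions identifies it with `η` plus an atom at `m₀`.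
  let μ : Measure S2 := (surfaceMeasure.restrict K).withDensity fun x => ENNReal.ofReal (F x)
  have : IsFiniteMeasure μ := isFiniteMeasure_withDensity_ofReal hF.2
  have hN : AEMeasurable (fun x : S2 => (optimal C (x : E3)).1) (surfaceMeasure.restrict K) :=
    measurable_fst.comp_aemeasurable (aemeasurable_optimal ha hK hT hsep hC)
  have hNμ : AEMeasurable (fun x : S2 => (optimal C (x : E3)).1) μ :=
    hN.mono_ac (withDensity_absolutelyContinuous _ _)
  have hflux : ∀ φ : S2 → ℝ, Measurable φ →
      ∫ m, φ m ∂(μ.map fun x : S2 => (optimal C (x : E3)).1) = flux K f C φ := by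
    intro φ hφ
    rw [integral_map hNμ hφ.aestronglyMeasurable,
      integral_withDensity_eq_integral_toReal_smul₀ hF.aemeasurable.ennreal_ofReal
        (.of_forall fun _ => ENNReal.ofReal_lt_top)]
    refine integral_congr_ae ?_
    filter_upwards [hF0] with x hx
    rw [ENNReal.toReal_ofReal hx, smul_eq_mul, mul_comm]
  have hint : ∀ φ : S2 → ℝ, Integrable φ η → Measurable φ →
      ∫ m, φ m ∂(η + ENNReal.ofReal r • Measure.dirac m₀) = ∫ m, φ m ∂η + r * φ m₀ := by
    intro φ hφ hφm
    rw [integral_add_measure hφ, integral_smul_measure, integral_dirac, smul_eq_mul,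
      ENNReal.toReal_ofReal hr]
    exact (integrable_dirac (by simp)).smul_measure ENNReal.ofReal_ne_top
  have : IsFiniteMeasure (ENNReal.ofReal r • Measure.dirac m₀) :=
    Measure.smul_finite _ ENNReal.ofReal_ne_top
  have heq : (μ.map fun x : S2 => (optimal C (x : E3)).1) =
      η + ENNReal.ofReal r • Measure.dirac m₀ := by
    refine ext_of_forall_integral_eq_of_IsFiniteMeasure fun φ => ?_
    rw [hflux φ φ.continuous.measurable, hint φ (φ.integrable η) φ.continuous.measurable, h φ]
  have hind : Measurable (E.indicator fun _ : S2 => (1 : ℝ)) := measurable_const.indicator hE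
  rw [← hflux _ hind, heq, hint _ ((integrable_const _).indicator hE) hind,
    integral_indicator_const _ hE, smul_eq_mul, mul_one]

/-! ### From optimal axes to the tracing map and irradiance -/

section Tracing

variable {C : NonemptyCompacts Paraboloid}

/-- The null boundary enters here: it discards the points of `K` where support over `K` gives no
information in a full neighbourhood. -/
lemma ae_mem_interior_and_differentiableAt (ha : 0 < a) (hC : ∀ p ∈ C, a ≤ p.2)
    (hK : IsClosed K) (hfr : surfaceMeasure (frontier K) = 0) :
    ∀ᵐ x : S2 ∂surfaceMeasure.restrict K,
      x ∈ interior K ∧ DifferentiableAt ℝ (envelope C) (x : E3) := by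
  have h : ∀ᵐ x : S2 ∂surfaceMeasure.restrict K, x ∉ frontier K :=
    ae_restrict_of_ae (by rw [ae_iff]; simpa using hfr)
  filter_upwards [ae_mem_and_differentiableAt ha hC hK, h] with x hx hxf
  refine ⟨?_, hx.2⟩
  by_contra hxi
  exact hxf ⟨subset_closure hx.1, hxi⟩

lemma tracing_ae_eq (ha : 0 < a) (hK : IsClosed K)
    (hsep : ∀ x ∈ K, ∀ m ∈ T, inner ℝ (x : E3) (m : E3) < 1)
    (hC : (C : Set Paraboloid) ⊆ T ×ˢ Icc a β) (hfr : surfaceMeasure (frontier K) = 0)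
    (E : Set S2) :
    tracing K T (fun z => (envelope C z)⁻¹) E =ᵐ[surfaceMeasure.restrict K]
      (fun x : S2 => (optimal C (x : E3)).1) ⁻¹' E := by
  have hC' : ∀ p ∈ C, a ≤ p.2 := fun p hp => (hC hp).2.1
  filter_upwards [ae_mem_interior_and_differentiableAt ha hC' hK hfr] with x hx
  exact propext (mem_tracing_iff ha hC' (fun p hp => (hC hp).1)
    (fun z hz p hp => hsep z hz _ (hC hp).1) hx.1 hx.2 E)

lemma nullMeasurableSet_tracing (ha : 0 < a) (hK : IsClosed K) (hT : IsCompact T)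
    (hsep : ∀ x ∈ K, ∀ m ∈ T, inner ℝ (x : E3) (m : E3) < 1)
    (hC : (C : Set Paraboloid) ⊆ T ×ˢ Icc a β) (hfr : surfaceMeasure (frontier K) = 0)
    {E : Set S2} (hE : MeasurableSet E) :
    NullMeasurableSet (tracing K T (fun z => (envelope C z)⁻¹) E) surfaceMeasure := by
  have h1 : NullMeasurableSet (tracing K T (fun z => (envelope C z)⁻¹) E)
      (surfaceMeasure.restrict K) :=
    ((measurable_fst.comp_aemeasurable
      (aemeasurable_optimal ha hK hT hsep hC)).nullMeasurableSet_preimage hE).congr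
      (tracing_ae_eq ha hK hsep hC hfr E).symm
  rw [nullMeasurableSet_restrict hK.measurableSet.nullMeasurableSet] at h1
  rwa [inter_eq_left.2 fun x hx => hx.1] at h1

lemma irradiance_ae_eq (ha : 0 < a) (hK : IsClosed K)
    (hsep : ∀ x ∈ K, ∀ m ∈ T, inner ℝ (x : E3) (m : E3) < 1)
    (hC : (C : Set Paraboloid) ⊆ T ×ˢ Icc a β) (hfr : surfaceMeasure (frontier K) = 0) :
    irradiance K f (fun z => (envelope C z)⁻¹) =ᵐ[surfaceMeasure.restrict K]
      fun x : S2 => f x * weight (optimal C (x : E3)) x := by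
  have hC' : ∀ p ∈ C, a ≤ p.2 := fun p hp => (hC hp).2.1
  filter_upwards [ae_mem_interior_and_differentiableAt ha hC' hK hfr] with x hx
  exact irradiance_envelope ha hC' (fun z hz p hp => hsep z hz _ (hC hp).1) hx.1 hx.2 f

lemma integrableOn_irradiance (ha : 0 < a) (hK : IsClosed K) (hT : IsCompact T)
    (hsep : ∀ x ∈ K, ∀ m ∈ T, inner ℝ (x : E3) (m : E3) < 1)
    (hC : (C : Set Paraboloid) ⊆ T ×ˢ Icc a β) (hfr : surfaceMeasure (frontier K) = 0)
    (hf : IntegrableOn f K surfaceMeasure) :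
    IntegrableOn (irradiance K f fun z => (envelope C z)⁻¹) K surfaceMeasure :=
  (integrable_mul_weight ha hK hT hsep hC hf).congr (irradiance_ae_eq ha hK hsep hC hfr).symm

lemma setIntegral_tracing_irradiance (ha : 0 < a) (hK : IsClosed K) (hT : IsCompact T)
    (hsep : ∀ x ∈ K, ∀ m ∈ T, inner ℝ (x : E3) (m : E3) < 1)
    (hC : (C : Set Paraboloid) ⊆ T ×ˢ Icc a β) (hfr : surfaceMeasure (frontier K) = 0)
    {E : Set S2} (hE : MeasurableSet E) :
    ∫ x in tracing K T (fun z => (envelope C z)⁻¹) E,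
      irradiance K f (fun z => (envelope C z)⁻¹) x ∂surfaceMeasure =
      flux K f C (E.indicator fun _ => 1) := by
  have h0 := nullMeasurableSet_tracing ha hK hT hsep hC hfr hE
  have hsub : tracing K T (fun z => (envelope C z)⁻¹) E ⊆ K := fun x hx => hx.1
  rw [← inter_eq_left.2 hsub, ← Measure.restrict_restrict₀ (h0.mono_ac
    Measure.absolutelyContinuous_restrict), ← integral_indicator₀ (h0.mono_ac
    Measure.absolutelyContinuous_restrict), flux]
  refine integral_congr_ae ?_
  filter_upwards [tracing_ae_eq ha hK hsep hC hfr E, irradiance_ae_eq (f := f) ha hK hsep hC hfr]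
    with x hx hxi
  have hiff : x ∈ tracing K T (fun z => (envelope C z)⁻¹) E ↔ (optimal C (x : E3)).1 ∈ E :=
    iff_of_eq hx
  by_cases hmem : (optimal C (x : E3)).1 ∈ E
  · rw [indicator_of_mem (hiff.2 hmem), indicator_of_mem hmem, one_mul, hxi]
  · rw [indicator_of_notMem (mt hiff.1 hmem), indicator_of_notMem hmem, zero_mul]

lemma le_inv_envelope (ha : 0 < a) (hC : ∀ p ∈ C, 2 * a ≤ p.2) {x : S2}
    (hx : ∀ p ∈ C, inner ℝ (x : E3) (p.1 : E3) < 1) : a ≤ (envelope C x)⁻¹ := by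
  have ha2 : 0 < 2 * a := by positivity
  have ho := optimal_mem ha2 hC x
  rw [le_inv_comm₀ ha (envelope_pos ha2 hC hx), envelope, gauge_sphere, inv_eq_one_div,
    div_le_div_iff₀ (ha2.trans_le (hC _ ho)) ha]
  have h1 := one_sub_inner_le_two x (optimal C (x : E3)).1
  have h2 := hC _ ho
  nlinarith

lemma inv_envelope_le (hδ : 0 < δ) (ha' : 0 < a') (ha : 0 < a) (hC : ∀ p ∈ C, a ≤ p.2)
    (hm₀ : (m₀, a') ∈ C) {x : S2} (hx : inner ℝ (x : E3) (m₀ : E3) ≤ 1 - δ) :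
    (envelope C x)⁻¹ ≤ a' / δ := by
  rw [← inv_div]
  refine inv_anti₀ (by positivity) (le_trans ?_ (gauge_le_envelope ha hC x hm₀))
  rw [gauge_sphere]
  gcongr
  simp only
  linarith

end Tracing

end FarField

end

/-! ### The main theorem -/

theorem mainTheorem4
    (Ω Ωs : Set FarField.S2)
    (hΩ : FarField.surfaceMeasure (frontier Ω) = 0)
    (δ : ℝ) (hδ0 : 0 < δ) (hδ1 : δ < 1)
    (hsep : ∀ x ∈ closure Ω, ∀ m ∈ closure Ωs,
      inner ℝ (x : FarField.E3) (m : FarField.E3) ≤ 1 - δ)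
    (f : FarField.S2 → ℝ)
    (hf : IntegrableOn f (closure Ω) FarField.surfaceMeasure)
    (hfpos : ∀ᵐ x ∂(FarField.surfaceMeasure.restrict (closure Ω)), 0 < f x)
    (η : Measure FarField.S2) [IsFiniteMeasure η] (hη : η (closure Ωs)ᶜ = 0)
    (a a' : ℝ) (ha : 0 < a) (ha' : 4 * a / δ ≤ a')
    (henergy : 1 / (δ ^ 3 / (2 * a' ^ 2)) * η.real (closure Ωs)
      ≤ ∫ x in closure Ω, f x ∂FarField.surfaceMeasure)
    (m₀ : FarField.S2) (hm₀ : m₀ ∈ η.support) :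
    ∃ ρ : FarField.S2 → ℝ,
      ρ ∈ FarField.ReflectorClass (closure Ω) (closure Ωs) a ∧
      (∀ x ∈ closure Ω, a ≤ ρ x ∧ ρ x ≤ a' / δ) ∧
      (∀ᵐ x ∂(FarField.surfaceMeasure.restrict (closure Ω)),
        ∃! ν : FarField.E3, FarField.IsOuterUnitNormal (closure Ω) ρ x ν) ∧
      ∀ E : Set FarField.S2, E ⊆ closure Ωs → MeasurableSet E →
        NullMeasurableSet (FarField.tracing (closure Ω) (closure Ωs) ρ E)
          FarField.surfaceMeasure ∧
        IntegrableOn (FarField.irradiance (closure Ω) f ρ)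
          (FarField.tracing (closure Ω) (closure Ωs) ρ E) FarField.surfaceMeasure ∧
        η.real E ≤ ∫ x in FarField.tracing (closure Ω) (closure Ωs) ρ E,
          FarField.irradiance (closure Ω) f ρ x ∂FarField.surfaceMeasure ∧
        (m₀ ∉ E → η.real E = ∫ x in FarField.tracing (closure Ω) (closure Ωs) ρ E,
          FarField.irradiance (closure Ω) f ρ x ∂FarField.surfaceMeasure) := by
  have hK : IsClosed (closure Ω) := isClosed_closure
  have hT : IsCompact (closure Ωs) := isClosed_closure.isCompact
  have ha2 : 0 < 2 * a := by positivity
  have ha'0 : 0 < a' := lt_of_lt_of_le (by positivity) ha'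
  have hfr : FarField.surfaceMeasure (frontier (closure Ω)) = 0 :=
    measure_mono_null frontier_closure_subset hΩ
  have hsep' : ∀ x ∈ closure Ω, ∀ m ∈ closure Ωs,
      inner ℝ (x : FarField.E3) (m : FarField.E3) < 1 := fun x hx m hm => by
    linarith [hsep x hx m hm]
  have hf0 : ∀ᵐ x ∂FarField.surfaceMeasure.restrict (closure Ω), 0 ≤ f x :=
    hfpos.mono fun x hx => hx.le
  -- Otherwise the complement of `closure Ωs` would be a null neighbourhood of a support point.
  have hm₀T : m₀ ∈ closure Ωs := by
    by_contra hm
    exact ((Measure.mem_support_iff_forall m₀).1 hm₀ _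
      (isClosed_closure.isOpen_compl.mem_nhds hm)).ne' hη
  have hmass : η.real univ = η.real (closure Ωs) := by
    have hT' : η.real (closure Ωs)ᶜ = 0 := by simp [measureReal_def, hη]
    rw [← measureReal_add_measureReal_compl (μ := η) hT.isClosed.measurableSet, hT', add_zero]
  have hpos : 0 < δ ^ 3 / (2 * a' ^ 2) := by positivity
  obtain ⟨C, hC, hCm₀, r, hr, hφ⟩ := FarField.exists_weak_reflector hδ0 hδ1 ha ha' hK hT hsep hf
    hf0 η hη hm₀T hm₀ (by
      rw [hmass]
      rwa [one_div, inv_mul_le_iff₀ hpos] at henergy)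
  have hCa : ∀ p ∈ C, 2 * a ≤ p.2 := fun p hp => (hC hp).2.1
  have hCsep : ∀ x ∈ closure Ω, ∀ p ∈ C, inner ℝ (x : FarField.E3) (p.1 : FarField.E3) < 1 :=
    fun x hx p hp => hsep' x hx _ (hC hp).1
  have hclass : ∀ x₀ ∈ closure Ω, ∃ m ∈ closure Ωs, ∃ d : ℝ, 2 * a ≤ d ∧
      FarField.Supports (closure Ω) (fun z => (FarField.envelope C z)⁻¹) d m x₀ := fun x₀ _ => by
    have ho := FarField.optimal_mem ha2 hCa (x₀ : FarField.E3)
    exact ⟨_, (hC ho).1, _, hCa _ ho, FarField.supports_optimal ha2 hCa hCsep x₀⟩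
  refine ⟨fun z => (FarField.envelope C z)⁻¹, ⟨fun x₀ hx₀ => ?_, hclass⟩, fun x hx =>
    ⟨FarField.le_inv_envelope ha hCa (hCsep x hx),
      FarField.inv_envelope_le hδ0 ha'0 ha2 hCa hCm₀ (hsep x hx m₀ hm₀T)⟩, ?_,
    fun E _ hE => ⟨FarField.nullMeasurableSet_tracing ha2 hK hT hsep' hC hfr hE,
      (FarField.integrableOn_irradiance ha2 hK hT hsep' hC hfr hf).mono_set fun x hx => hx.1, ?_⟩⟩
  · obtain ⟨m, hm, d, -, hs⟩ := hclass x₀ hx₀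
    exact ⟨m, hm, d, hs⟩
  · filter_upwards [FarField.ae_mem_interior_and_differentiableAt ha2 hCa hK hfr] with x hx
    exact FarField.existsUnique_isOuterUnitNormal ha2 hCa hCsep hx.1 hx.2
  -- The integral equals `η(E)` plus `r ≥ 0` times the indicator of `E` at `m₀`, which gives both
  -- the inequality and the case of equality.
  · rw [FarField.setIntegral_tracing_irradiance ha2 hK hT hsep' hC hfr hE,
      FarField.flux_indicator_eq ha2 hK hT hsep' hf hf0 hC η hr hφ hE]
    refine ⟨le_add_of_nonneg_right (mul_nonneg hr (indicator_nonneg (by simp) _)), fun hmE => ?_⟩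
    rw [indicator_of_notMem hmE, mul_zero, add_zero]
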